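/- Let $(X,d)$ be a complete separable metric space and $\mathfrak m\ge 0$ a boundedly-finite Borel measure on $X$ (that is, $\mathfrak m(B)<\infty$ for every bounded Borel set $B$). Let $p\in[1,\infty)$ and let $q\in(1,\infty]$ be the conjugate exponent, $\frac1p+\frac1q=1$. **Dirichlet functions.** For a family $\Gamma$ of curves, $\mathrm{Mod}_p(\Gamma)=\inf\int\rho^p\,d\mathfrak m$, over all Borel $\rho:X\to[0,\infty]$ with $\rho \in \mathcal L^p(\mathfrak m)$ and $\int_\gamma\rho\,ds\ge1$ for all $\gamma\in\Gamma$ (with $\int_\gamma\rho\,ds=\infty$ if $\gamma$ is not rectifiable). A $p$-integrable Borel function $\rho:X\to[0,\infty]$ is a weak $p$-upper gradient of $f:X\to\mathbb R$ if $|f(\gamma_b)-f(\gamma_a)|\le\int_\gamma\rho\,ds$ for $\mathrm{Mod}_p$-a.e. nonconstant rectifiable curve $\gamma:[a,b]\to X$. The Dirichlet space $D^{1,p}_{\mathfrak m}(X)$ consists of the $\mathfrak m$-a.e. classes of $\mathfrak m$-measurable functions having a representative with a weak $p$-upper gradient, and $|Df|\in L^p(\mathfrak m)^+$ denotes the $\mathfrak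 m$-a.e. minimal weak $p$-upper gradient of $f$ (among all those of all representatives of $f$). $\mathrm{LIP}_{bs}(X)$ is the space of bounded Lipschitz functions with bounded support; it is mapped to $D^{1,p}_{\mathfrak m}(X)$ by taking classes. **Modules.** The cotangent module $L^p(T^*X)$ is the $L^p(\mathfrak m)$-normed $L^\infty(\mathfrak m)$-module generated by $f\mapsto|Df|$, with linear differential $d:D^{1,p}_{\mathfrak m}(X)\to L^p(T^*X)$: we have $|df|=|Df|$, and the finite sums $\sum_i\mathbb 1_{E_i}df_i$ ($(E_i)$ a Borel partition of $X$) are dense. The tangent module $L^q(TX)$ is its module dual, i.e. the space of all $L^\infty(\mathfrak m)$-linear continuous maps $v:L^p(T^*X)\to L^1(\mathfrak m)$, $\omega\mapsto\omega(v)$, with pointwise norm $|v|=\bigvee\{\omega(v):|\omega|\le1\ \mathfrak m\text{-a.e.}\}$ (a supremum in the lattice of $\mathfrak m$-a.e. classes). **Measures.** A boundedly-finite signed Borel measure on $X$ is a real-valued function $\mu$ on the bounded Borel sets such that $E\mapsto\mu(E\cap B)$ is a finite signed Borel measure for every bounded Borel set $B$. Its positive part $\mu^+$ is the nonnegative Borel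 measure glued from the positive parts of these restrictions, $\mu^-=(-\mu)^+$, and $\int\psi\,d\mu=\int\psi\,d\mu^+-\int\psi\,d\mu^-$. **Divergence, gradients, Laplacians.** A vector field $v\in L^q(TX)$ has divergence $\mathrm{div}_q(v)=\mu$, for a boundedly-finite signed Borel measure $\mu$, if $\int d\psi(v)\,d\mathfrak m=-\int\psi\,d\mu$ for all $\psi\in\mathrm{LIP}_{bs}(X)$. For $f\in D^{1,p}_{\mathfrak m}(X)$, $\mathrm{Grad}_q(f)$ is the set of all $v\in L^q(TX)$ with $$df(v)=|Df|^p\quad\text{and}\quad|v|=|Df|^{p/q}\qquad\mathfrak m\text{-a.e.},$$ where for $q=\infty$ we set $a^{p/q}=1$ if $a>0$ and $a^{p/q}=0$ if $a=0$. Finally, $\Delta_p(f)$ is the set of all boundedly-finite signed Borel measures $\mu$ such that $$-\int\psi\,d\mu\le\int_{\{|Df|>0\}}\frac{|D(f+\psi)|^p-|Df|^p}{p}\,d\mathfrak m\qquad\text{for every }\psi\in\mathrm{LIP}_{bs}(X).$$ **Theorem.** Let $f\in D^{1,p}_{\mathfrak m}(X)$. For every $\mu\in\Delta_p(f)$ there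 is $w_\mu\in L^q(TX)$ such that $w_\mu\in\mathrm{Grad}_q(f)$ and $\mathrm{div}_q(w_\mu)=\mu$. Moreover, $$\Delta_p(f)=\{\mathrm{div}_q(v)\,:\,v\in\mathrm{Grad}_q(f)\text{ has a divergence}\}.$$ -/

import Mathlib

open MeasureTheory Set Filter Topology
open scoped ENNReal NNReal

noncomputable section

namespace MetricSobolev

/-! ### The lattice of extended nonnegative measurable functions modulo a.e. equality -/

section EssentialBounds

variable {α : Type*} [MeasurableSpace α]

theorem exists_isGLB_aeEqFun (μ : Measure α) [SigmaFinite μ] (S : Set (α →ₘ[μ] ℝ≥0∞)) :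
    ∃ G, IsGLB S G := by
  rcases S.eq_empty_or_nonempty with rfl | ⟨s₀, hs₀⟩
  · refine ⟨AEEqFun.const α ∞, by simp, fun G _ => ?_⟩
    rw [← AEEqFun.coeFn_le]
    filter_upwards [AEEqFun.coeFn_const (μ := μ) α (∞ : ℝ≥0∞)] with x hx
    rw [hx]; exact le_top
  have : Nonempty S := ⟨⟨s₀, hs₀⟩⟩
  set ν : Measure α := μ.toFinite with hν
  have hae : ae ν = ae μ := ae_toFinite
  let I : (ℕ → S) → α → ℝ≥0∞ := fun f x => ⨅ n, (f n : α →ₘ[μ] ℝ≥0∞) x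
  have hI : ∀ f, Measurable (I f) := fun f => Measurable.iInf fun n => (f n).1.measurable
  let J : (ℕ → S) → ℝ≥0∞ := fun f => ∫⁻ x, (1 + I f x)⁻¹ ∂ν
  have hJm : ∀ f, Measurable fun x => (1 + I f x)⁻¹ := fun f => ((hI f).const_add 1).inv
  have hJfin : ∀ f, J f ≠ ∞ := by
    intro f
    refine ne_of_lt (lt_of_le_of_lt (lintegral_mono (g := fun _ => 1) fun x => ?_) ?_)
    · simp [ENNReal.inv_le_one]
    · simp
  obtain ⟨u, -, hu, hus⟩ := exists_seq_tendsto_sSup (S := range J) (range_nonempty J)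
    (OrderTop.bddAbove _)
  choose f hf using hus
  let F : ℕ → S := fun n => f n.unpair.1 n.unpair.2
  have hFle : ∀ k x, I F x ≤ I (f k) x := fun k x => le_iInf fun n =>
    (iInf_le _ (Nat.pair k n)).trans (by simp [F])
  have hmax : ∀ g, J g ≤ J F := by
    intro g
    refine (le_sSup (mem_range_self g)).trans (le_of_tendsto' hu fun k => ?_)
    rw [← hf k]
    exact lintegral_mono fun x => ENNReal.inv_le_inv.2 (add_le_add_right (hFle k x) 1)
  refine ⟨AEEqFun.mk (I F) (hI F).aestronglyMeasurable, fun s hs => ?_, fun G hG => ?_⟩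
  · let F' : ℕ → S := fun n => Nat.casesOn n ⟨s, hs⟩ F
    have h1 : ∀ x, I F' x ≤ I F x := fun x => le_iInf fun n => iInf_le _ (n + 1)
    have h2 : ∀ x, I F' x ≤ s x := fun x => iInf_le _ 0
    have h3 : (fun x => (1 + I F x)⁻¹) =ᵐ[ν] fun x => (1 + I F' x)⁻¹ :=
      ae_eq_of_ae_le_of_lintegral_le
        (Eventually.of_forall fun x => ENNReal.inv_le_inv.2 (add_le_add_right (h1 x) 1))
        (hJfin F) (hJm F').aemeasurable (hmax F')
    rw [EventuallyEq, hae] at h3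
    rw [← AEEqFun.coeFn_le]
    filter_upwards [h3, AEEqFun.coeFn_mk (I F) (hI F).aestronglyMeasurable] with x hx hx'
    rw [hx']
    have h4 : I F x = I F' x := by
      have := inv_injective hx
      rwa [ENNReal.add_right_inj ENNReal.one_ne_top] at this
    rw [h4]; exact h2 x
  · rw [← AEEqFun.coeFn_le]
    have h : ∀ n, G ≤ᵐ[μ] (F n : α →ₘ[μ] ℝ≥0∞) := fun n => AEEqFun.coeFn_le.2 (hG (F n).2)
    filter_upwards [ae_all_iff.2 h, AEEqFun.coeFn_mk (I F) (hI F).aestronglyMeasurable] with x hx hx'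
    rw [hx']
    exact le_iInf hx

/-- The infimum of a family in the lattice of `μ`-a.e. classes of `[0, ∞]`-valued functions. -/
def latticeInf (μ : Measure α) [SigmaFinite μ] (S : Set (α →ₘ[μ] ℝ≥0∞)) : α →ₘ[μ] ℝ≥0∞ :=
  Classical.choose (exists_isGLB_aeEqFun μ S)

theorem isGLB_latticeInf (μ : Measure α) [SigmaFinite μ] (S : Set (α →ₘ[μ] ℝ≥0∞)) :
    IsGLB S (latticeInf μ S) :=
  Classical.choose_spec (exists_isGLB_aeEqFun μ S)

/-- The supremum of a family in the lattice of `μ`-a.e. classes of `[0, ∞]`-valued functions. -/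
def latticeSup (μ : Measure α) [SigmaFinite μ] (S : Set (α →ₘ[μ] ℝ≥0∞)) : α →ₘ[μ] ℝ≥0∞ :=
  latticeInf μ (upperBounds S)

theorem isLUB_latticeSup (μ : Measure α) [SigmaFinite μ] (S : Set (α →ₘ[μ] ℝ≥0∞)) :
    IsLUB S (latticeSup μ S) :=
  isGLB_upperBounds.1 (isGLB_latticeInf μ (upperBounds S))

end EssentialBounds

/-! ### Metric measure spaces, curves, modulus -/

/-- A measure on a metric space is boundedly finite if bounded Borel sets have finite measure. -/
class BoundedlyFinite {X : Type*} [MetricSpace X] [MeasurableSpace X] (m : Measure X) :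
    Prop where
  lt_top : ∀ B : Set X, MeasurableSet B → Bornology.IsBounded B → m B < ∞

instance {X : Type*} [MetricSpace X] [MeasurableSpace X] [BorelSpace X] (m : Measure X)
    [BoundedlyFinite m] : IsLocallyFiniteMeasure m where
  finiteAtNhds x := ⟨Metric.ball x 1, Metric.ball_mem_nhds x one_pos,
    BoundedlyFinite.lt_top _ Metric.isOpen_ball.measurableSet Metric.isBounded_ball⟩

/-- A curve `γ : [a, b] → X`, `a < b`; the values of `toFun` outside `[a, b]` play no role. -/
structure Curve (X : Type*) [MetricSpace X] where
  a : ℝ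
  b : ℝ
  lt : a < b
  toFun : ℝ → X
  continuousOn : ContinuousOn toFun (Icc a b)

namespace Curve

variable {X : Type*} [MetricSpace X]

/-- The length of a curve. -/
def length (γ : Curve X) : ℝ≥0∞ := eVariationOn γ.toFun (Icc γ.a γ.b)

/-- A curve is rectifiable if its length is finite. -/
def Rectifiable (γ : Curve X) : Prop := γ.length ≠ ∞

/-- A curve is nonconstant if it takes at least two values. -/
def Nonconstant (γ : Curve X) : Prop := ∃ t ∈ Icc γ.a γ.b, γ.toFun t ≠ γ.toFun γ.a

/-- The constant-speed reparametrisation `γᶜˢ : [0, 1] → X` of a rectifiable curve, obtained by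
rescaling the arc-length parametrisation. -/
def constSpeed (γ : Curve X) (t : ℝ) : X :=
  naturalParameterization γ.toFun (Icc γ.a γ.b) γ.a (γ.length.toReal * t)

open Classical in
/-- The path integral `∫_γ ρ ds`, equal to `∞` if `γ` is not rectifiable. -/
def pathIntegral (ρ : X → ℝ≥0∞) (γ : Curve X) : ℝ≥0∞ :=
  if γ.Rectifiable then γ.length * ∫⁻ t in Icc (0 : ℝ) 1, ρ (γ.constSpeed t) else ∞

theorem pathIntegral_mono {ρ ρ' : X → ℝ≥0∞} (h : ∀ x, ρ x ≤ ρ' x) (γ : Curve X) :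
    γ.pathIntegral ρ ≤ γ.pathIntegral ρ' := by
  unfold pathIntegral
  split_ifs with hγ
  · exact mul_le_mul_right (lintegral_mono fun t => h _) _
  · exact le_rfl

theorem le_pathIntegral_add (ρ ρ' : X → ℝ≥0∞) (γ : Curve X) :
    γ.pathIntegral ρ + γ.pathIntegral ρ' ≤ γ.pathIntegral (fun x => ρ x + ρ' x) := by
  unfold pathIntegral
  split_ifs with hγ
  · rw [← mul_add]
    exact mul_le_mul_right (le_lintegral_add _ _) _
  · exact le_top

theorem pathIntegral_const_mul (c : ℝ≥0∞) (hc : c ≠ ∞) (hc' : c ≠ 0) (ρ : X → ℝ≥0∞)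
    (γ : Curve X) : γ.pathIntegral (fun x => c * ρ x) = c * γ.pathIntegral ρ := by
  unfold pathIntegral
  split_ifs with hγ
  · rw [lintegral_const_mul' _ _ hc]; ring
  · rw [ENNReal.mul_top hc']

end Curve

section Modulus

variable {X : Type*} [MetricSpace X] [MeasurableSpace X]

/-- The `p`-modulus of a family of curves. -/
def modulus (m : Measure X) (p : ℝ) (Γ : Set (Curve X)) : ℝ≥0∞ :=
  ⨅ (ρ : X → ℝ≥0∞) (_ : Measurable ρ ∧ ∫⁻ x, ρ x ^ p ∂m < ∞ ∧ ∀ γ ∈ Γ, 1 ≤ γ.pathIntegral ρ),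
    ∫⁻ x, ρ x ^ p ∂m

theorem modulus_eq_zero_union {m : Measure X} {p : ℝ} {Γ Γ' : Set (Curve X)}
    (h : modulus m p Γ = 0) (h' : modulus m p Γ' = 0) : modulus m p (Γ ∪ Γ') = 0 := by
  have key : ∀ {Δ : Set (Curve X)}, modulus m p Δ = 0 → ∀ ε : ℝ≥0∞, 0 < ε →
      ∃ ρ : X → ℝ≥0∞, Measurable ρ ∧ ∫⁻ x, ρ x ^ p ∂m < ε ∧ ∀ γ ∈ Δ, 1 ≤ γ.pathIntegral ρ := by
    intro Δ hΔ ε hε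
    rw [← hΔ, modulus, iInf_lt_iff] at hε
    obtain ⟨ρ, hρ⟩ := hε
    rw [iInf_lt_iff] at hρ
    obtain ⟨⟨h1, -, h3⟩, h4⟩ := hρ
    exact ⟨ρ, h1, h4, h3⟩
  refine le_antisymm (ENNReal.le_of_forall_pos_le_add fun ε hε _ => ?_) zero_le
  rw [zero_add]
  have hε2 : (0 : ℝ≥0∞) < (ε : ℝ≥0∞) / 2 := ENNReal.div_pos (by simpa using hε.ne') (by simp)
  obtain ⟨ρ, h1, h2, h3⟩ := key h _ hε2
  obtain ⟨ρ', h1', h2', h3'⟩ := key h' _ hε2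
  have hle : ∫⁻ x, (max (ρ x) (ρ' x)) ^ p ∂m ≤ ε := by
    calc ∫⁻ x, (max (ρ x) (ρ' x)) ^ p ∂m ≤ ∫⁻ x, (ρ x ^ p + ρ' x ^ p) ∂m := by
          refine lintegral_mono fun x => ?_
          rcases le_total (ρ x) (ρ' x) with hx | hx
          · simp [max_eq_right hx]
          · simp [max_eq_left hx]
      _ = ∫⁻ x, ρ x ^ p ∂m + ∫⁻ x, ρ' x ^ p ∂m := lintegral_add_left (h1.pow_const p) _
      _ ≤ ε / 2 + ε / 2 := add_le_add h2.le h2'.le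
      _ = ε := ENNReal.add_halves _
  refine (iInf₂_le (fun x => max (ρ x) (ρ' x))
    ⟨h1.max h1', hle.trans_lt ENNReal.coe_lt_top, ?_⟩).trans hle
  rintro γ (hγ | hγ)
  · exact (h3 γ hγ).trans (γ.pathIntegral_mono (fun x => le_max_left _ _))
  · exact (h3' γ hγ).trans (γ.pathIntegral_mono (fun x => le_max_right _ _))

theorem modulus_empty (m : Measure X) {p : ℝ} (hp : 0 < p) : modulus m p ∅ = 0 := by
  refine le_antisymm ?_ zero_le
  refine (iInf₂_le (fun _ => 0) ⟨measurable_const, ?_, by simp⟩).trans ?_ <;>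
  simp [ENNReal.zero_rpow_of_pos hp]

theorem modulus_mono_zero {m : Measure X} {p : ℝ} {Γ Γ' : Set (Curve X)} (hs : Γ ⊆ Γ')
    (h' : modulus m p Γ' = 0) : modulus m p Γ = 0 := by
  refine le_antisymm (le_trans ?_ h'.le) zero_le
  refine le_iInf₂ fun ρ hρ => iInf₂_le ρ ⟨hρ.1, hρ.2.1, fun γ hγ => hρ.2.2 γ (hs hγ)⟩

/-- `ρ` is a weak `p`-upper gradient of the real-valued function `f`: it is a `p`-integrable Borel
function such that the upper gradient inequality holds along `Mod_p`-a.e. nonconstant rectifiable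
curve. -/
structure IsWeakUpperGradient (m : Measure X) (p : ℝ) (f : X → ℝ) (ρ : X → ℝ≥0∞) : Prop where
  measurable : Measurable ρ
  lintegral_lt_top : ∫⁻ x, ρ x ^ p ∂m < ∞
  modulus_eq_zero : modulus m p {γ : Curve X | γ.Rectifiable ∧ γ.Nonconstant ∧
    ¬ ENNReal.ofReal |f (γ.toFun γ.b) - f (γ.toFun γ.a)| ≤ γ.pathIntegral ρ} = 0

theorem IsWeakUpperGradient.add {m : Measure X} {p : ℝ} (hp : 1 ≤ p) {f g : X → ℝ}
    {ρ ρ' : X → ℝ≥0∞} (h : IsWeakUpperGradient m p f ρ) (h' : IsWeakUpperGradient m p g ρ') :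
    IsWeakUpperGradient m p (fun x => f x + g x) (fun x => ρ x + ρ' x) where
  measurable := h.measurable.add h'.measurable
  lintegral_lt_top := by
    refine lt_of_le_of_lt (lintegral_mono fun x =>
      ENNReal.rpow_add_le_mul_rpow_add_rpow (ρ x) (ρ' x) hp) ?_
    have hc : (2 : ℝ≥0∞) ^ (p - 1) ≠ ∞ := ENNReal.rpow_ne_top_of_nonneg (by linarith) (by simp)
    rw [lintegral_const_mul' _ _ hc, lintegral_add_left (h.measurable.pow_const p)]
    exact ENNReal.mul_lt_top hc.lt_top
      (ENNReal.add_lt_top.2 ⟨h.lintegral_lt_top, h'.lintegral_lt_top⟩)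
  modulus_eq_zero := by
    refine modulus_mono_zero ?_ (modulus_eq_zero_union h.modulus_eq_zero h'.modulus_eq_zero)
    rintro γ ⟨h1, h2, h3⟩
    by_contra hcon
    simp only [mem_union, mem_ofPred_eq, h1, h2, true_and, not_or, not_not] at hcon
    refine h3 (le_trans ?_ ((add_le_add hcon.1 hcon.2).trans (γ.le_pathIntegral_add ρ ρ')))
    rw [← ENNReal.ofReal_add (abs_nonneg _) (abs_nonneg _)]
    refine ENNReal.ofReal_le_ofReal (le_trans (le_of_eq ?_) (abs_add_le _ _))
    congr 1; ring

theorem IsWeakUpperGradient.const_mul {m : Measure X} {p : ℝ} (hp : 1 ≤ p) {f : X → ℝ}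
    {ρ : X → ℝ≥0∞} (h : IsWeakUpperGradient m p f ρ) {c : ℝ} (hc : c ≠ 0) :
    IsWeakUpperGradient m p (fun x => c * f x) (fun x => ENNReal.ofReal |c| * ρ x) where
  measurable := h.measurable.const_mul _
  lintegral_lt_top := by
    simp_rw [ENNReal.mul_rpow_of_nonneg _ _ (zero_le_one.trans hp)]
    rw [lintegral_const_mul _ (h.measurable.pow_const p)]
    exact ENNReal.mul_lt_top (ENNReal.rpow_lt_top_of_nonneg (by linarith) (by simp))
      h.lintegral_lt_top
  modulus_eq_zero := by
    refine modulus_mono_zero ?_ h.modulus_eq_zero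
    rintro γ ⟨h1, h2, h3⟩
    refine ⟨h1, h2, fun h4 => h3 ?_⟩
    rw [γ.pathIntegral_const_mul _ (by simp) (by simpa using hc), ← mul_sub, abs_mul,
      ENNReal.ofReal_mul (abs_nonneg _)]
    exact mul_le_mul_right h4 _

theorem IsWeakUpperGradient.zero (m : Measure X) {p : ℝ} (hp : 1 ≤ p) :
    IsWeakUpperGradient m p (fun _ => 0) (fun _ => 0) where
  measurable := measurable_const
  lintegral_lt_top := by simp [ENNReal.zero_rpow_of_pos (zero_lt_one.trans_le hp)]
  modulus_eq_zero := by
    convert modulus_empty m (zero_lt_one.trans_le hp) using 2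
    ext γ; simp

end Modulus

/-! ### Dirichlet functions and minimal weak upper gradients -/

instance {p : ℝ} [Fact (1 ≤ p)] : Fact (1 ≤ ENNReal.ofReal p) :=
  ⟨by simpa using ENNReal.ofReal_le_ofReal (Fact.out : 1 ≤ p)⟩

section Dirichlet

variable {X : Type*} [MetricSpace X] [MeasurableSpace X]

/-- The Dirichlet space: `m`-a.e. classes of real-valued `m`-measurable functions having a
representative that admits a weak `p`-upper gradient. -/
def Dirichlet (m : Measure X) (p : ℝ) [hp : Fact (1 ≤ p)] : Submodule ℝ (X →ₘ[m] ℝ) where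
  carrier := {F | ∃ f : X → ℝ, F =ᵐ[m] f ∧ ∃ ρ, IsWeakUpperGradient m p f ρ}
  zero_mem' := ⟨fun _ => 0, AEEqFun.coeFn_zero, _, IsWeakUpperGradient.zero m hp.out⟩
  add_mem' := by
    rintro F G ⟨f, hf, ρ, hρ⟩ ⟨g, hg, ρ', hρ'⟩
    exact ⟨_, (AEEqFun.coeFn_add F G).trans (hf.add hg), _, hρ.add hp.out hρ'⟩
  smul_mem' := by
    rintro c F ⟨f, hf, ρ, hρ⟩
    rcases eq_or_ne c 0 with rfl | hc
    · rw [zero_smul]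
      exact ⟨fun _ => 0, AEEqFun.coeFn_zero, _, IsWeakUpperGradient.zero m hp.out⟩
    · refine ⟨fun x => c * f x, (AEEqFun.coeFn_smul c F).trans ?_, _, hρ.const_mul hp.out hc⟩
      filter_upwards [hf] with x hx
      simp [hx]

variable (m : Measure X) (p : ℝ)

/-- The classes of all weak `p`-upper gradients of all representatives of `F`. -/
def weakUpperGradients (F : X →ₘ[m] ℝ) : Set (X →ₘ[m] ℝ≥0∞) :=
  {G | ∃ (f : X → ℝ) (ρ : X → ℝ≥0∞), F =ᵐ[m] f ∧ IsWeakUpperGradient m p f ρ ∧ G =ᵐ[m] ρ}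

variable [SigmaFinite m]

/-- The minimal weak `p`-upper gradient of `F` as a `[0, ∞]`-valued class: the `m`-a.e. minimal
one, i.e. the infimum of all weak `p`-upper gradients in the `m`-a.e. order. -/
def minimalWUG (F : X →ₘ[m] ℝ) : X →ₘ[m] ℝ≥0∞ := latticeInf m (weakUpperGradients m p F)

variable {m p}

theorem minimalWUG_le {F : X →ₘ[m] ℝ} {f : X → ℝ} {ρ : X → ℝ≥0∞} (hf : F =ᵐ[m] f)
    (hρ : IsWeakUpperGradient m p f ρ) : minimalWUG m p F ≤ᵐ[m] ρ := by
  have h := AEEqFun.coeFn_le.2 ((isGLB_latticeInf m (weakUpperGradients m p F)).1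
    ⟨f, ρ, hf, hρ, AEEqFun.coeFn_mk ρ hρ.measurable.aestronglyMeasurable⟩)
  exact h.trans (AEEqFun.coeFn_mk ρ hρ.measurable.aestronglyMeasurable).le

theorem le_minimalWUG {F : X →ₘ[m] ℝ} {h : X → ℝ≥0∞} (hm : Measurable h)
    (hh : ∀ f ρ, F =ᵐ[m] f → IsWeakUpperGradient m p f ρ → h ≤ᵐ[m] ρ) :
    h ≤ᵐ[m] minimalWUG m p F := by
  have h1 := AEEqFun.coeFn_mk h (μ := m) hm.aestronglyMeasurable
  have : AEEqFun.mk h hm.aestronglyMeasurable ≤ minimalWUG m p F := by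
    refine (isGLB_latticeInf m (weakUpperGradients m p F)).2 ?_
    rintro G ⟨f, ρ, hf, hρ, hG⟩
    exact AEEqFun.coeFn_le.1 ((h1.le.trans (hh f ρ hf hρ)).trans hG.symm.le)
  exact h1.symm.le.trans (AEEqFun.coeFn_le.2 this)

variable [Fact (1 ≤ p)]

theorem minimalWUG_lt_top (F : Dirichlet m p) : ∀ᵐ x ∂m, minimalWUG m p F x < ∞ := by
  obtain ⟨f, hf, ρ, hρ⟩ := F.2
  have hp : 0 < p := zero_lt_one.trans_le Fact.out
  filter_upwards [minimalWUG_le hf hρ,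
    ae_lt_top (hρ.measurable.pow_const p) hρ.lintegral_lt_top.ne] with x h1 h2
  exact h1.trans_lt ((ENNReal.rpow_lt_top_iff_of_pos hp).1 h2)

theorem minimalWUG_add_le (F G : Dirichlet m p) :
    ∀ᵐ x ∂m, minimalWUG m p (F + G : X →ₘ[m] ℝ) x ≤ minimalWUG m p F x + minimalWUG m p G x := by
  have hp : 1 ≤ p := Fact.out
  have hm : ∀ H : X →ₘ[m] ℝ, Measurable (minimalWUG m p H) := fun H => AEEqFun.measurable _
  have h1 : ∀ f ρ, (F : X →ₘ[m] ℝ) =ᵐ[m] f → IsWeakUpperGradient m p f ρ →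
      ∀ᵐ x ∂m, minimalWUG m p (F + G : X →ₘ[m] ℝ) x - ρ x ≤ minimalWUG m p G x := by
    intro f ρ hf hρ
    refine le_minimalWUG ((hm _).sub hρ.measurable) fun g ρ' hg hρ' => ?_
    filter_upwards [minimalWUG_le ((AEEqFun.coeFn_add (F : X →ₘ[m] ℝ) G).trans (hf.add hg))
      (hρ.add hp hρ')] with x hx
    exact tsub_le_iff_left.2 hx
  have h2 := le_minimalWUG (F := (F : X →ₘ[m] ℝ)) (p := p)
    ((hm (F + G : X →ₘ[m] ℝ)).sub (hm (G : X →ₘ[m] ℝ))) (fun f ρ hf hρ => by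
      filter_upwards [h1 f ρ hf hρ] with x hx
      rw [tsub_le_iff_right] at hx
      exact tsub_le_iff_left.2 hx)
  filter_upwards [h2] with x hx
  exact tsub_le_iff_right.1 hx

theorem minimalWUG_smul_le (F : Dirichlet m p) {c : ℝ} (hc : c ≠ 0) :
    ∀ᵐ x ∂m, minimalWUG m p (c • F : X →ₘ[m] ℝ) x ≤ ENNReal.ofReal |c| * minimalWUG m p F x := by
  have hp : 1 ≤ p := Fact.out
  have h0 : ENNReal.ofReal |c| ≠ 0 := by simpa using hc
  have h := le_minimalWUG (F := (F : X →ₘ[m] ℝ)) (p := p)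
    (h := fun x => (ENNReal.ofReal |c|)⁻¹ * minimalWUG m p (c • F : X →ₘ[m] ℝ) x)
    ((AEEqFun.measurable _).const_mul _) (fun f ρ hf hρ => by
      have hf' : (c • F : X →ₘ[m] ℝ) =ᵐ[m] fun x => c * f x := by
        filter_upwards [AEEqFun.coeFn_smul c (F : X →ₘ[m] ℝ), hf] with x h1 h2
        rw [h1, Pi.smul_apply, h2, smul_eq_mul]
      filter_upwards [minimalWUG_le hf' (hρ.const_mul hp hc)] with x hx
      rwa [ENNReal.inv_mul_le_iff h0 (by simp)])
  filter_upwards [h] with x hx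
  rwa [ENNReal.inv_mul_le_iff h0 (by simp)] at hx

theorem memLp_minimalWUG (F : Dirichlet m p) :
    MemLp (fun x => (minimalWUG m p F x).toReal) (ENNReal.ofReal p) m := by
  obtain ⟨f, hf, ρ, hρ⟩ := F.2
  have hp : 0 < p := zero_lt_one.trans_le Fact.out
  refine ⟨(AEEqFun.measurable _).ennreal_toReal.aestronglyMeasurable, ?_⟩
  rw [eLpNorm_lt_top_iff_lintegral_rpow_enorm_lt_top (by simpa using hp) (by simp),
    ENNReal.toReal_ofReal hp.le]
  refine lt_of_le_of_lt (lintegral_mono_ae ?_) hρ.lintegral_lt_top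
  filter_upwards [minimalWUG_le hf hρ, minimalWUG_lt_top F] with x h1 h2
  refine ENNReal.rpow_le_rpow ?_ hp.le
  rw [Real.enorm_eq_ofReal ENNReal.toReal_nonneg, ENNReal.ofReal_toReal h2.ne]
  exact h1

/-- The minimal weak upper gradient `|Df| ∈ Lᵖ(m)⁺` of a Dirichlet function. -/
def gradNorm (F : Dirichlet m p) : Lp ℝ (ENNReal.ofReal p) m := (memLp_minimalWUG F).toLp

theorem coeFn_gradNorm (F : Dirichlet m p) :
    gradNorm F =ᵐ[m] fun x => (minimalWUG m p F x).toReal := MemLp.coeFn_toLp _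

theorem gradNorm_nonneg (F : Dirichlet m p) : ∀ᵐ x ∂m, 0 ≤ gradNorm F x := by
  filter_upwards [coeFn_gradNorm F] with x hx
  rw [hx]; exact ENNReal.toReal_nonneg

theorem gradNorm_add_le (F G : Dirichlet m p) :
    ∀ᵐ x ∂m, gradNorm (F + G) x ≤ gradNorm F x + gradNorm G x := by
  filter_upwards [coeFn_gradNorm F, coeFn_gradNorm G, coeFn_gradNorm (F + G),
    minimalWUG_add_le F G, minimalWUG_lt_top F, minimalWUG_lt_top G] with x h1 h2 h3 h4 h5 h6
  rw [h1, h2, h3, ← ENNReal.toReal_add h5.ne h6.ne]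
  exact ENNReal.toReal_mono (ENNReal.add_lt_top.2 ⟨h5, h6⟩).ne h4

theorem gradNorm_zero : ∀ᵐ x ∂m, gradNorm (0 : Dirichlet m p) x = 0 := by
  filter_upwards [coeFn_gradNorm (0 : Dirichlet m p),
    minimalWUG_le (F := ((0 : Dirichlet m p) : X →ₘ[m] ℝ)) AEEqFun.coeFn_zero
      (IsWeakUpperGradient.zero m (Fact.out : 1 ≤ p))] with x h1 h2
  rw [h1, nonpos_iff_eq_zero.1 h2, ENNReal.toReal_zero]

theorem gradNorm_smul (c : ℝ) (F : Dirichlet m p) :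
    ∀ᵐ x ∂m, gradNorm (c • F) x = |c| * gradNorm F x := by
  have key : ∀ (c : ℝ) (F : Dirichlet m p), c ≠ 0 →
      ∀ᵐ x ∂m, gradNorm (c • F) x ≤ |c| * gradNorm F x := by
    intro c F hc
    filter_upwards [coeFn_gradNorm F, coeFn_gradNorm (c • F), minimalWUG_smul_le F hc,
      minimalWUG_lt_top F] with x h1 h2 h3 h4
    rw [h1, h2]
    refine (ENNReal.toReal_mono (ENNReal.mul_lt_top (by simp) h4).ne h3).trans (le_of_eq ?_)
    rw [ENNReal.toReal_mul, ENNReal.toReal_ofReal (abs_nonneg c)]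
  rcases eq_or_ne c 0 with rfl | hc
  · filter_upwards [gradNorm_zero (m := m) (p := p)] with x hx
    rw [zero_smul, hx, abs_zero, zero_mul]
  · filter_upwards [key c F hc, key c⁻¹ (c • F) (inv_ne_zero hc)] with x h1 h2
    rw [inv_smul_smul₀ hc, abs_inv] at h2
    refine le_antisymm h1 ?_
    rwa [← div_eq_inv_mul, le_div_iff₀ (abs_pos.2 hc), mul_comm] at h2

end Dirichlet

/-! ### Boundedly supported Lipschitz functions are Dirichlet functions -/

/-- The space `LIP_bs(X)` of bounded Lipschitz functions with bounded support. -/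
structure LipBS (X : Type*) [MetricSpace X] where
  toFun : X → ℝ
  lipschitz : ∃ K : ℝ≥0, LipschitzWith K toFun
  bounded : ∃ C : ℝ, ∀ x, |toFun x| ≤ C
  isBounded_support : Bornology.IsBounded (Function.support toFun)

namespace Curve

variable {X : Type*} [MetricSpace X] (γ : Curve X)

/-- The length of `γ` restricted to `[a, t]`. -/
def arcLength (t : ℝ) : ℝ := variationOnFromTo γ.toFun (Icc γ.a γ.b) γ.a t

variable {γ}

theorem arcLength_add (hγ : γ.Rectifiable) {s t : ℝ} (hs : s ∈ Icc γ.a γ.b)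
    (ht : t ∈ Icc γ.a γ.b) :
    γ.arcLength s + variationOnFromTo γ.toFun (Icc γ.a γ.b) s t = γ.arcLength t :=
  variationOnFromTo.add (BoundedVariationOn.locallyBoundedVariationOn hγ)
    (left_mem_Icc.2 γ.lt.le) hs ht

theorem arcLength_a : γ.arcLength γ.a = 0 := variationOnFromTo.self _ _ _

theorem arcLength_b : γ.arcLength γ.b = γ.length.toReal := by
  rw [arcLength, variationOnFromTo.eq_of_le _ _ γ.lt.le, inter_self, length]

theorem arcLength_mono (hγ : γ.Rectifiable) : MonotoneOn γ.arcLength (Icc γ.a γ.b) :=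
  variationOnFromTo.monotoneOn (BoundedVariationOn.locallyBoundedVariationOn hγ)
    (left_mem_Icc.2 γ.lt.le)

theorem dist_le_arcLength (hγ : γ.Rectifiable) {s t : ℝ} (hs : s ∈ Icc γ.a γ.b)
    (ht : t ∈ Icc γ.a γ.b) (hst : s ≤ t) :
    dist (γ.toFun t) (γ.toFun s) ≤ γ.arcLength t - γ.arcLength s := by
  have hle := eVariationOn.edist_le γ.toFun (s := Icc γ.a γ.b ∩ Icc s t)
    (x := t) (y := s) ⟨ht, hst, le_rfl⟩ ⟨hs, le_rfl, hst⟩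
  have hfin : eVariationOn γ.toFun (Icc γ.a γ.b ∩ Icc s t) ≠ ∞ :=
    ne_top_of_le_ne_top hγ (eVariationOn.mono _ inter_subset_left)
  rw [← arcLength_add hγ hs ht, variationOnFromTo.eq_of_le _ _ hst, add_sub_cancel_left,
    dist_edist]
  exact ENNReal.toReal_mono hfin hle

theorem continuousOn_arcLength (hγ : γ.Rectifiable) :
    ContinuousOn γ.arcLength (Icc γ.a γ.b) := by
  intro x hx
  have hbv : BoundedVariationOn γ.toFun (Icc γ.a γ.b) := hγ
  have hl := hbv.tendsto_eVariationOn_Icc_zero_left (x := x)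
    ((γ.continuousOn x hx).mono inter_subset_left)
  have hr := hbv.tendsto_eVariationOn_Icc_zero_right x
    ((γ.continuousOn x hx).mono inter_subset_left)
  have hlr := ((ENNReal.tendsto_toReal ENNReal.zero_ne_top).comp hl).add
    ((ENNReal.tendsto_toReal ENNReal.zero_ne_top).comp hr)
  rw [ENNReal.toReal_zero, add_zero] at hlr
  rw [ContinuousWithinAt, tendsto_iff_dist_tendsto_zero]
  refine squeeze_zero' (Eventually.of_forall fun _ => dist_nonneg) ?_ hlr
  filter_upwards [self_mem_nhdsWithin] with y hy
  simp only [Function.comp_apply]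
  rw [← arcLength_add hγ hx hy, Real.dist_eq, add_sub_cancel_left]
  rcases le_total x y with h | h
  · rw [variationOnFromTo.eq_of_le _ _ h, abs_of_nonneg ENNReal.toReal_nonneg]
    exact le_add_of_nonneg_left ENNReal.toReal_nonneg
  · rw [variationOnFromTo.eq_of_ge _ _ h, abs_neg, abs_of_nonneg ENNReal.toReal_nonneg]
    exact le_add_of_nonneg_right ENNReal.toReal_nonneg

/-- The constant-speed reparametrisation takes at time `t` the value of `γ` at a time at which the
length of the initial piece of `γ` equals `t` times the length of `γ`. -/
theorem exists_constSpeed_eq (hγ : γ.Rectifiable) {t : ℝ} (ht : t ∈ Icc (0 : ℝ) 1) :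
    ∃ c ∈ Icc γ.a γ.b, γ.arcLength c = γ.length.toReal * t ∧ γ.constSpeed t = γ.toFun c := by
  have hmem : γ.length.toReal * t ∈ γ.arcLength '' Icc γ.a γ.b := by
    refine intermediate_value_Icc γ.lt.le (continuousOn_arcLength hγ) ?_
    rw [arcLength_a, arcLength_b]
    exact ⟨mul_nonneg ENNReal.toReal_nonneg ht.1,
      mul_le_of_le_one_right ENNReal.toReal_nonneg ht.2⟩
  have : Nonempty ℝ := ⟨γ.a⟩
  obtain ⟨h1, h2⟩ := Function.invFunOn_pos hmem
  exact ⟨_, h1, h2, rfl⟩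

theorem ofReal_abs_sub_le_pathIntegral (hγ : γ.Rectifiable) {ψ : X → ℝ} {K : ℝ≥0}
    (hψ : LipschitzWith K ψ) :
    ENNReal.ofReal |ψ (γ.toFun γ.b) - ψ (γ.toFun γ.a)| ≤
      γ.pathIntegral ((Function.support ψ).indicator fun _ => (K : ℝ≥0∞)) := by
  have ha : γ.a ∈ Icc γ.a γ.b := left_mem_Icc.2 γ.lt.le
  have hb : γ.b ∈ Icc γ.a γ.b := right_mem_Icc.2 γ.lt.le
  have hlip : ∀ {s t : ℝ}, s ∈ Icc γ.a γ.b → t ∈ Icc γ.a γ.b → s ≤ t →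
      |ψ (γ.toFun t) - ψ (γ.toFun s)| ≤ K * (γ.arcLength t - γ.arcLength s) := by
    intro s t hs ht hst
    rw [← Real.dist_eq]
    exact (hψ.dist_le_mul _ _).trans
      (mul_le_mul_of_nonneg_left (dist_le_arcLength hγ hs ht hst) K.2)
  set l : ℝ := γ.length.toReal with hl
  have hl0 : 0 ≤ l := ENNReal.toReal_nonneg
  have hlen : γ.length = ENNReal.ofReal l := (ENNReal.ofReal_toReal hγ).symm
  rw [pathIntegral, if_pos hγ, hlen]
  have hcl : IsClosed (Icc γ.a γ.b ∩ (fun t => ψ (γ.toFun t)) ⁻¹' {0}) :=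
    (hψ.continuous.comp_continuousOn γ.continuousOn).preimage_isClosed_of_isClosed isClosed_Icc
      isClosed_singleton
  set Z := Icc γ.a γ.b ∩ (fun t => ψ (γ.toFun t)) ⁻¹' {0} with hZ
  rcases Z.eq_empty_or_nonempty with hZe | hZn
  · have h1 : ∀ t ∈ Icc (0 : ℝ) 1, (Function.support ψ).indicator (fun _ => (K : ℝ≥0∞))
        (γ.constSpeed t) = K := by
      intro t ht
      obtain ⟨c, hc, -, hct⟩ := exists_constSpeed_eq hγ ht
      rw [hct]
      refine indicator_of_mem (fun h0 => ?_) _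
      have : c ∈ Z := ⟨hc, h0⟩
      rw [hZe] at this
      exact this
    rw [setLIntegral_congr_fun measurableSet_Icc h1, setLIntegral_const, Real.volume_Icc, sub_zero,
      ENNReal.ofReal_one, mul_one, ← ENNReal.ofReal_coe_nnreal, ← ENNReal.ofReal_mul hl0]
    refine ENNReal.ofReal_le_ofReal ((hlip ha hb γ.lt.le).trans (le_of_eq ?_))
    rw [arcLength_a, arcLength_b, sub_zero, mul_comm]
  · have hZc : IsCompact Z := isCompact_Icc.of_isClosed_subset hcl inter_subset_left
    have h1 : sInf Z ∈ Z := hZc.sInf_mem hZn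
    have h2 : sSup Z ∈ Z := hZc.sSup_mem hZn
    set c₁ := sInf Z
    set c₂ := sSup Z
    have h12 : c₁ ≤ c₂ := csInf_le hZc.bddBelow h2
    have hV12 : γ.arcLength c₁ ≤ γ.arcLength c₂ := arcLength_mono hγ h1.1 h2.1 h12
    have hV1 : 0 ≤ γ.arcLength c₁ := by
      simpa [arcLength_a] using arcLength_mono hγ ha h1.1 h1.1.1
    have hV2 : γ.arcLength c₂ ≤ l := by
      simpa [arcLength_b] using arcLength_mono hγ h2.1 hb h2.1.2
    have hz1 : ψ (γ.toFun c₁) = 0 := h1.2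
    have hz2 : ψ (γ.toFun c₂) = 0 := h2.2
    have e1 : |ψ (γ.toFun γ.a)| ≤ K * γ.arcLength c₁ := by
      have := hlip ha h1.1 h1.1.1
      rwa [hz1, arcLength_a, sub_zero, zero_sub, abs_neg] at this
    have e2 : |ψ (γ.toFun γ.b)| ≤ K * (l - γ.arcLength c₂) := by
      have := hlip h2.1 hb h2.1.2
      rwa [hz2, arcLength_b, sub_zero] at this
    have e3 : |ψ (γ.toFun γ.b) - ψ (γ.toFun γ.a)| ≤
        K * (γ.arcLength c₁ + (l - γ.arcLength c₂)) := by
      refine (abs_sub _ _).trans ?_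
      rw [mul_add]; linarith
    rcases hl0.eq_or_lt with hl0' | hlpos
    · have : γ.arcLength c₁ + (l - γ.arcLength c₂) ≤ 0 := by linarith
      have h0 := e3.trans (mul_nonpos_of_nonneg_of_nonpos K.2 this)
      rw [ENNReal.ofReal_of_nonpos h0]; exact zero_le
    set A : Set ℝ := Ico 0 (γ.arcLength c₁ / l)
    set B : Set ℝ := Ioc (γ.arcLength c₂ / l) 1
    have hA1 : γ.arcLength c₁ / l ≤ 1 := (div_le_one hlpos).2 (hV12.trans hV2)
    have hB0 : 0 ≤ γ.arcLength c₂ / l := div_nonneg (hV1.trans hV12) hl0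
    have hAB : Disjoint A B := by
      rw [Set.disjoint_left]
      intro t htA htB
      have := div_le_div_of_nonneg_right hV12 hl0
      exact absurd (htA.2.trans_le (this.trans htB.1.le)) (lt_irrefl _)
    have hvol : volume (A ∪ B) = ENNReal.ofReal ((γ.arcLength c₁ + (l - γ.arcLength c₂)) / l) := by
      rw [measure_union hAB measurableSet_Ioc, Real.volume_Ico, Real.volume_Ioc,
        ← ENNReal.ofReal_add (by rw [sub_zero]; exact div_nonneg hV1 hl0)
          (by rw [sub_nonneg]; exact (div_le_one hlpos).2 hV2)]
      congr 1; field_simp; ring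
    have hsub : A ∪ B ⊆ Icc 0 1 := by
      rintro t (ht | ht)
      · exact ⟨ht.1, ht.2.le.trans hA1⟩
      · exact ⟨hB0.trans ht.1.le, ht.2⟩
    have hind : ∀ t ∈ A ∪ B, (Function.support ψ).indicator (fun _ => (K : ℝ≥0∞))
        (γ.constSpeed t) = K := by
      intro t ht
      obtain ⟨c, hc, hct, hcs⟩ := exists_constSpeed_eq hγ (hsub ht)
      rw [hcs]
      refine indicator_of_mem (fun h0 => ?_) _
      have hcZ : c ∈ Z := ⟨hc, h0⟩
      rcases ht with ht | ht
      · have := (lt_div_iff₀ hlpos).1 ht.2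
        have h3 := arcLength_mono hγ h1.1 hc (csInf_le hZc.bddBelow hcZ)
        rw [hct] at h3
        exact absurd (h3.trans_lt ((mul_comm _ _).trans_lt this)) (lt_irrefl _)
      · have := (div_lt_iff₀ hlpos).1 ht.1
        have h3 := arcLength_mono hγ hc h2.1 (le_csSup hZc.bddAbove hcZ)
        rw [hct] at h3
        exact absurd (this.trans_le ((mul_comm _ _).trans_le h3)) (lt_irrefl _)
    calc ENNReal.ofReal |ψ (γ.toFun γ.b) - ψ (γ.toFun γ.a)|
        ≤ ENNReal.ofReal (K * (γ.arcLength c₁ + (l - γ.arcLength c₂))) :=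
          ENNReal.ofReal_le_ofReal e3
      _ = ENNReal.ofReal l * (K * volume (A ∪ B)) := by
          rw [hvol, ← ENNReal.ofReal_coe_nnreal, ← ENNReal.ofReal_mul K.coe_nonneg, ← ENNReal.ofReal_mul hl0]
          congr 1; field_simp
      _ = ENNReal.ofReal l * ∫⁻ t in A ∪ B, (Function.support ψ).indicator
            (fun _ => (K : ℝ≥0∞)) (γ.constSpeed t) := by
          rw [setLIntegral_congr_fun (measurableSet_Ico.union measurableSet_Ioc) hind,
            setLIntegral_const]
      _ ≤ _ := mul_le_mul_right (lintegral_mono_set hsub) _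

end Curve

namespace LipBS

variable {X : Type*} [MetricSpace X]

theorem continuous (ψ : LipBS X) : Continuous ψ.toFun :=
  ψ.lipschitz.choose_spec.continuous

variable [MeasurableSpace X] [BorelSpace X]

theorem exists_isWeakUpperGradient (m : Measure X) [BoundedlyFinite m] {p : ℝ} (hp : 1 ≤ p)
    (ψ : LipBS X) : ∃ ρ, IsWeakUpperGradient m p ψ.toFun ρ := by
  obtain ⟨K, hK⟩ := ψ.lipschitz
  have hmeas : MeasurableSet (Function.support ψ.toFun) :=
    ψ.continuous.isOpen_support.measurableSet
  refine ⟨(Function.support ψ.toFun).indicator fun _ => (K : ℝ≥0∞),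
    measurable_const.indicator hmeas, ?_, ?_⟩
  · have hp0 : 0 < p := zero_lt_one.trans_le hp
    have : ∀ x, (Function.support ψ.toFun).indicator (fun _ => (K : ℝ≥0∞)) x ^ p =
        (Function.support ψ.toFun).indicator (fun _ => (K : ℝ≥0∞) ^ p) x := by
      intro x
      by_cases hx : x ∈ Function.support ψ.toFun
      · simp only [indicator_of_mem hx]
      · simp only [indicator_of_notMem hx, ENNReal.zero_rpow_of_pos hp0]
    simp_rw [this]
    rw [lintegral_indicator_const hmeas]
    exact ENNReal.mul_lt_top (ENNReal.rpow_lt_top_of_nonneg hp0.le ENNReal.coe_ne_top)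
      (BoundedlyFinite.lt_top _ hmeas ψ.isBounded_support)
  · convert modulus_empty m (zero_lt_one.trans_le hp) using 2
    refine eq_empty_of_forall_notMem fun γ hγ => hγ.2.2 ?_
    exact Curve.ofReal_abs_sub_le_pathIntegral hγ.1 hK

/-- The `m`-a.e. class of a boundedly supported Lipschitz function, as a Dirichlet function. -/
def toDirichlet (m : Measure X) [BoundedlyFinite m] (p : ℝ) [hp : Fact (1 ≤ p)] (ψ : LipBS X) :
    Dirichlet m p :=
  ⟨AEEqFun.mk ψ.toFun ψ.continuous.aestronglyMeasurable, ψ.toFun, AEEqFun.coeFn_mk _ _,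
    ψ.exists_isWeakUpperGradient m hp.out⟩

end LipBS

/-! ### The cotangent module -/

section Cotangent

theorem ae_simpleFunc {α β : Type*} [MeasurableSpace α] {m : Measure α} {P : β → α → Prop}
    (h : ∀ b, ∀ᵐ x ∂m, P b x) (s : SimpleFunc α β) : ∀ᵐ x ∂m, P (s x) x := by
  have : ∀ᵐ x ∂m, ∀ b ∈ s.range, P b x := by
    rw [Filter.eventually_all_finset]
    exact fun b _ => h b
  filter_upwards [this] with x hx
  exact hx _ (SimpleFunc.mem_range_self s x)

section SimpleDense

variable {X : Type*} [MeasurableSpace X] (m : Measure X)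

/-- The class in `L^∞(m)` of a real-valued simple function. -/
def simpleToLInfty : SimpleFunc X ℝ →ₗ[ℝ] Lp ℝ ∞ m where
  toFun φ := (SimpleFunc.memLp_top φ m).toLp
  map_add' φ φ' := MemLp.toLp_add (SimpleFunc.memLp_top φ m) (SimpleFunc.memLp_top φ' m)
  map_smul' c φ := MemLp.toLp_const_smul c (SimpleFunc.memLp_top φ m)

variable {m} in
theorem coeFn_simpleToLInfty (φ : SimpleFunc X ℝ) : simpleToLInfty m φ =ᵐ[m] φ :=
  MemLp.coeFn_toLp (SimpleFunc.memLp_top φ m)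

variable {m} in
theorem ae_abs_le_norm (g : Lp ℝ ∞ m) : ∀ᵐ x ∂m, |g x| ≤ ‖g‖ := by
  filter_upwards [ae_le_eLpNormEssSup (f := g) (μ := m)] with x hx
  rw [← eLpNorm_exponent_top] at hx
  have := ENNReal.toReal_mono (Lp.eLpNorm_ne_top g) hx
  rwa [toReal_enorm, Real.norm_eq_abs, ← Lp.norm_def] at this

theorem denseRange_simpleToLInfty : DenseRange (simpleToLInfty m) := by
  intro g
  rw [Metric.mem_closure_range_iff]
  intro ε hε
  set C : ℝ := ‖g‖
  set u : X → ℝ := fun x => max (-C) (min (g x) C)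
  have hu : Measurable u :=
    measurable_const.max ((Lp.stronglyMeasurable g).measurable.min measurable_const)
  have hC : 0 ≤ C := norm_nonneg g
  have hub : ∀ x, u x ∈ Icc (-C) C := fun x =>
    ⟨le_max_left _ _, max_le (by linarith) (min_le_right _ _)⟩
  have hug : ∀ᵐ x ∂m, u x = g x := by
    filter_upwards [ae_abs_le_norm g] with x hx
    have := abs_le.1 hx
    simp only [u]
    rw [min_eq_left this.2, max_eq_right this.1]
  set δ : ℝ := ε / 2
  have hδ : 0 < δ := half_pos hε
  let φ : SimpleFunc X ℝ :=
    { toFun := fun x => δ * (⌊u x / δ⌋ : ℝ)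
      measurableSet_fiber' := fun y => by
        have : Measurable fun x => δ * (⌊u x / δ⌋ : ℝ) :=
          ((measurable_from_top (f := fun n : ℤ => (n : ℝ))).comp
            (hu.div_const δ).floor).const_mul δ
        exact this (measurableSet_singleton y)
      finite_range' := by
        refine ((Set.finite_Icc ⌊-C / δ⌋ ⌊C / δ⌋).image fun n : ℤ => δ * (n : ℝ)).subset ?_
        rintro _ ⟨x, rfl⟩
        exact ⟨⌊u x / δ⌋, ⟨Int.floor_mono (div_le_div_of_nonneg_right (hub x).1 hδ.le),
          Int.floor_mono (div_le_div_of_nonneg_right (hub x).2 hδ.le)⟩, rfl⟩ }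
  refine ⟨φ, ?_⟩
  rw [dist_eq_norm]
  refine lt_of_le_of_lt (b := δ) ?_ (half_lt_self hε)
  rw [Lp.norm_def, eLpNorm_exponent_top]
  refine ENNReal.toReal_le_of_le_ofReal hδ.le (eLpNormEssSup_le_of_ae_bound ?_)
  · filter_upwards [Lp.coeFn_sub g (simpleToLInfty m φ), coeFn_simpleToLInfty (m := m) φ, hug]
      with x h1 h2 h3
    rw [h1, Pi.sub_apply, h2, ← h3, Real.norm_eq_abs]
    change |u x - δ * (⌊u x / δ⌋ : ℝ)| ≤ δ
    have e1 := Int.floor_le (u x / δ)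
    have e2 := Int.lt_floor_add_one (u x / δ)
    rw [le_div_iff₀ hδ] at e1
    rw [div_lt_iff₀ hδ] at e2
    rw [abs_le]; constructor <;> nlinarith

end SimpleDense

variable {X : Type*} [MetricSpace X] [MeasurableSpace X]

/-- The pre-cotangent module: finite formal sums `∑ᵢ 1_{Eᵢ} dfᵢ`, with `(Eᵢ)` a finite Borel
partition of `X` and `fᵢ` Dirichlet functions, are encoded as simple functions with values in the
Dirichlet space. -/
def PreCotangent (m : Measure X) (p : ℝ) [Fact (1 ≤ p)] : Type _ :=
  SimpleFunc X (Dirichlet m p)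

namespace PreCotangent

variable {m : Measure X} {p : ℝ} [Fact (1 ≤ p)]

instance : AddCommGroup (PreCotangent m p) :=
  inferInstanceAs (AddCommGroup (SimpleFunc X (Dirichlet m p)))

instance : Module ℝ (PreCotangent m p) :=
  inferInstanceAs (Module ℝ (SimpleFunc X (Dirichlet m p)))

/-- The underlying simple function. -/
def toSimpleFunc (s : PreCotangent m p) : SimpleFunc X (Dirichlet m p) := s

/-- The element `∑ᵢ aᵢ 1_{Eᵢ} dfᵢ`, for a real-valued simple function `φ = ∑ᵢ aᵢ 1_{Eᵢ}` and
`s = ∑ᵢ 1_{Eᵢ} dfᵢ`. -/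
def simpleMul (φ : SimpleFunc X ℝ) (s : PreCotangent m p) : PreCotangent m p :=
  (φ.pair s.toSimpleFunc).map fun z => z.1 • z.2

/-- The element `1_X df`. -/
def const (F : Dirichlet m p) : PreCotangent m p := SimpleFunc.const X F

theorem simpleMul_apply (φ : SimpleFunc X ℝ) (s : PreCotangent m p) (x : X) :
    (simpleMul φ s).toSimpleFunc x = φ x • s.toSimpleFunc x := rfl

theorem add_apply (s t : PreCotangent m p) (x : X) :
    (s + t).toSimpleFunc x = s.toSimpleFunc x + t.toSimpleFunc x := rfl

theorem smul_apply (c : ℝ) (s : PreCotangent m p) (x : X) :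
    (c • s).toSimpleFunc x = c • s.toSimpleFunc x := rfl

theorem ext' {s t : PreCotangent m p} (h : ∀ x, s.toSimpleFunc x = t.toSimpleFunc x) : s = t :=
  SimpleFunc.ext h

/-- `simpleMul` as a bilinear map. -/
def simpleMulₗ : PreCotangent m p →ₗ[ℝ] SimpleFunc X ℝ →ₗ[ℝ] PreCotangent m p :=
  LinearMap.mk₂ ℝ (fun s φ => simpleMul φ s)
    (fun s t φ => ext' fun x => by simp only [simpleMul_apply, add_apply, smul_add])
    (fun c s φ => ext' fun x => by simp only [simpleMul_apply, smul_apply, smul_comm c])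
    (fun s φ φ' => ext' fun x => by
      simp only [simpleMul_apply, add_apply, SimpleFunc.coe_add, Pi.add_apply, add_smul])
    (fun c s φ => ext' fun x => by
      simp only [simpleMul_apply, smul_apply, SimpleFunc.coe_smul, Pi.smul_apply, smul_assoc])

variable [SigmaFinite m]

theorem memLp_pointwise (s : PreCotangent m p) :
    MemLp (fun x => gradNorm (s.toSimpleFunc x) x) (ENNReal.ofReal p) m := by
  classical
  have h : (fun x => gradNorm (s.toSimpleFunc x) x) =
      fun x => ∑ F ∈ s.toSimpleFunc.range, (s.toSimpleFunc ⁻¹' {F}).indicator (gradNorm F) x := by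
    funext x
    rw [Finset.sum_eq_single (s.toSimpleFunc x)]
    · exact (indicator_of_mem (show x ∈ s.toSimpleFunc ⁻¹' {s.toSimpleFunc x} from rfl) _).symm
    · intro F _ hF
      exact indicator_of_notMem (fun h => hF h.symm) _
    · exact fun h => absurd (SimpleFunc.mem_range_self _ x) h
  rw [h]
  exact memLp_finsetSum _ fun F _ => (Lp.memLp (gradNorm F)).indicator
    (SimpleFunc.measurableSet_fiber _ _)

/-- The pointwise norm `|∑ᵢ 1_{Eᵢ} dfᵢ| = ∑ᵢ 1_{Eᵢ} |Dfᵢ| ∈ Lᵖ(m)⁺`. -/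
def pointwiseNorm (s : PreCotangent m p) : Lp ℝ (ENNReal.ofReal p) m := s.memLp_pointwise.toLp

theorem coeFn_pointwiseNorm (s : PreCotangent m p) :
    pointwiseNorm s =ᵐ[m] fun x => gradNorm (s.toSimpleFunc x) x := MemLp.coeFn_toLp _

theorem pointwiseNorm_nonneg (s : PreCotangent m p) : ∀ᵐ x ∂m, 0 ≤ pointwiseNorm s x := by
  filter_upwards [coeFn_pointwiseNorm s, ae_simpleFunc gradNorm_nonneg s.toSimpleFunc] with x h1 h2
  rwa [h1]

theorem pointwiseNorm_add_le (s t : PreCotangent m p) :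
    ∀ᵐ x ∂m, pointwiseNorm (s + t) x ≤ pointwiseNorm s x + pointwiseNorm t x := by
  filter_upwards [coeFn_pointwiseNorm s, coeFn_pointwiseNorm t, coeFn_pointwiseNorm (s + t),
    ae_simpleFunc (P := fun (b : Dirichlet m p × Dirichlet m p) x =>
      gradNorm (b.1 + b.2) x ≤ gradNorm b.1 x + gradNorm b.2 x)
      (fun b => gradNorm_add_le b.1 b.2) (s.toSimpleFunc.pair t.toSimpleFunc)] with x h1 h2 h3 h4
  rw [h1, h2, h3]
  exact h4

theorem pointwiseNorm_simpleMul (φ : SimpleFunc X ℝ) (s : PreCotangent m p) :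
    ∀ᵐ x ∂m, pointwiseNorm (simpleMul φ s) x = |φ x| * pointwiseNorm s x := by
  filter_upwards [coeFn_pointwiseNorm s, coeFn_pointwiseNorm (simpleMul φ s),
    ae_simpleFunc (P := fun (b : ℝ × Dirichlet m p) x =>
      gradNorm (b.1 • b.2) x = |b.1| * gradNorm b.2 x)
      (fun b => gradNorm_smul b.1 b.2) (φ.pair s.toSimpleFunc)] with x h1 h2 h3
  rw [h1, h2]
  exact h3

theorem pointwiseNorm_smul (c : ℝ) (s : PreCotangent m p) :
    ∀ᵐ x ∂m, pointwiseNorm (c • s) x = |c| * pointwiseNorm s x :=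
  pointwiseNorm_simpleMul (SimpleFunc.const X c) s

instance : Norm (PreCotangent m p) := ⟨fun s => ‖pointwiseNorm s‖⟩

theorem norm_def (s : PreCotangent m p) : ‖s‖ = ‖pointwiseNorm s‖ := rfl

theorem seminormCore : SeminormedSpace.Core ℝ (PreCotangent m p) where
  norm_nonneg s := norm_nonneg (pointwiseNorm s)
  norm_smul c s := by
    have h : pointwiseNorm (c • s) = |c| • pointwiseNorm s := by
      refine Lp.ext ?_
      filter_upwards [pointwiseNorm_smul c s, Lp.coeFn_smul |c| (pointwiseNorm s)] with x h1 h2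
      rw [h1, h2]; rfl
    rw [norm_def, norm_def, h, norm_smul, Real.norm_eq_abs, abs_abs, Real.norm_eq_abs]
  norm_triangle s t := by
    refine le_trans (Lp.norm_le_norm_of_ae_le ?_) (norm_add_le (pointwiseNorm s) (pointwiseNorm t))
    filter_upwards [pointwiseNorm_add_le s t, pointwiseNorm_nonneg (s + t),
      Lp.coeFn_add (pointwiseNorm s) (pointwiseNorm t)] with x h1 h2 h3
    rw [h3, Real.norm_of_nonneg h2]
    exact h1.trans (le_abs_self _)

instance : SeminormedAddCommGroup (PreCotangent m p) :=
  SeminormedAddCommGroup.ofCore seminormCore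

instance : NormedSpace ℝ (PreCotangent m p) where
  norm_smul_le c s := (seminormCore.norm_smul c s).le

theorem abs_pointwiseNorm_sub_le (s t : PreCotangent m p) :
    ∀ᵐ x ∂m, |pointwiseNorm s x - pointwiseNorm t x| ≤ pointwiseNorm (s - t) x := by
  have h1 := pointwiseNorm_add_le (s - t) t
  have h2 := pointwiseNorm_add_le (-1 • (s - t)) s
  have h3 := pointwiseNorm_smul (-1) (s - t)
  rw [sub_add_cancel] at h1
  have e : (-1 : ℝ) • (s - t) = -(s - t) := by rw [neg_smul, one_smul]
  have e' : (-1 : ℤ) • (s - t) + s = t := by simp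
  rw [e'] at h2
  have e'' : (-1 : ℤ) • (s - t) = (-1 : ℝ) • (s - t) := by simp
  rw [e''] at h2
  filter_upwards [h1, h2, h3] with x a1 a2 a3
  rw [a3, abs_neg, abs_one, one_mul] at a2
  rw [abs_le]; constructor <;> linarith

theorem lipschitzWith_pointwiseNorm :
    LipschitzWith 1 (pointwiseNorm : PreCotangent m p → Lp ℝ (ENNReal.ofReal p) m) := by
  refine LipschitzWith.of_dist_le_mul fun s t => ?_
  rw [NNReal.coe_one, one_mul, dist_eq_norm, dist_eq_norm, norm_def]
  refine Lp.norm_le_norm_of_ae_le ?_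
  filter_upwards [abs_pointwiseNorm_sub_le s t, Lp.coeFn_sub (pointwiseNorm s) (pointwiseNorm t)]
    with x h1 h2
  rw [h2]
  exact h1.trans (le_abs_self _)

end PreCotangent

/-- The cotangent module `Lᵖ(T*X)`: the completion of the pre-cotangent module. -/
abbrev Cotangent (m : Measure X) (p : ℝ) [Fact (1 ≤ p)] [SigmaFinite m] : Type _ :=
  UniformSpace.Completion (PreCotangent m p)

variable {m : Measure X} {p : ℝ} [Fact (1 ≤ p)] [SigmaFinite m]

/-- The differential `d : D^{1,p}_m(X) → Lᵖ(T*X)`. -/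
def differential : Dirichlet m p →ₗ[ℝ] Cotangent m p where
  toFun F := (PreCotangent.const F : Cotangent m p)
  map_add' F G := UniformSpace.Completion.coe_add (PreCotangent.const F) (PreCotangent.const G)
  map_smul' c F := UniformSpace.Completion.coe_smul c (PreCotangent.const F)

/-- The pointwise norm `|ω| ∈ Lᵖ(m)⁺` of `ω ∈ Lᵖ(T*X)`, extended by continuity. -/
def cotangentNorm : Cotangent m p → Lp ℝ (ENNReal.ofReal p) m :=
  UniformSpace.Completion.extension PreCotangent.pointwiseNorm

theorem cotangentNorm_coe (s : PreCotangent m p) :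
    cotangentNorm (s : Cotangent m p) = PreCotangent.pointwiseNorm s :=
  UniformSpace.Completion.extension_coe
    PreCotangent.lipschitzWith_pointwiseNorm.uniformContinuous s

theorem cotangentNorm_differential (F : Dirichlet m p) :
    cotangentNorm (differential F) = gradNorm F :=
  (cotangentNorm_coe (PreCotangent.const F)).trans
    (Lp.ext (PreCotangent.coeFn_pointwiseNorm (PreCotangent.const F)))

theorem PreCotangent.norm_simpleMul_le (φ : SimpleFunc X ℝ) (s : PreCotangent m p) :
    ‖simpleMul φ s‖ ≤ ‖s‖ * ‖simpleToLInfty m φ‖ := by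
  rw [mul_comm]
  refine Lp.norm_le_mul_norm_of_ae_le_mul ?_
  filter_upwards [pointwiseNorm_simpleMul φ s, coeFn_simpleToLInfty (m := m) φ,
    ae_abs_le_norm (simpleToLInfty m φ)] with x h1 h2 h3
  rw [h1, norm_mul, Real.norm_eq_abs, abs_abs, ← h2]
  exact mul_le_mul_of_nonneg_right h3 (norm_nonneg _)

/-- The canonical map of the pre-cotangent module into its completion. -/
def PreCotangent.incl : PreCotangent m p →ₗ[ℝ] Cotangent m p :=
  (UniformSpace.Completion.toComplₗᵢ (𝕜 := ℝ)).toLinearMap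

/-- For `s` in the pre-cotangent module, the map `L^∞(m) → Lᵖ(T*X)`, `g ↦ g s`: the continuous
extension of multiplication by simple functions. -/
def PreCotangent.mulRight (s : PreCotangent m p) : Lp ℝ ∞ m →L[ℝ] Cotangent m p :=
  (PreCotangent.incl ∘ₗ PreCotangent.simpleMulₗ s).extendOfNorm (simpleToLInfty m)

theorem PreCotangent.mulRight_simple (s : PreCotangent m p) (φ : SimpleFunc X ℝ) :
    s.mulRight (simpleToLInfty m φ) = (simpleMul φ s : Cotangent m p) :=
  LinearMap.extendOfNorm_eq (denseRange_simpleToLInfty m)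
    ⟨‖s‖, fun φ => (UniformSpace.Completion.norm_coe (simpleMul φ s)).trans_le
      (PreCotangent.norm_simpleMul_le φ s)⟩ φ

theorem PreCotangent.norm_mulRight_le (s : PreCotangent m p) : ‖s.mulRight‖ ≤ ‖s‖ :=
  LinearMap.opNorm_extendOfNorm_le (denseRange_simpleToLInfty m) (norm_nonneg s)
    fun φ => (UniformSpace.Completion.norm_coe (simpleMul φ s)).trans_le
      (PreCotangent.norm_simpleMul_le φ s)

/-- `PreCotangent.mulRight` as a linear map. -/
def PreCotangent.mulRightₗ : PreCotangent m p →ₗ[ℝ] Lp ℝ ∞ m →L[ℝ] Cotangent m p where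
  toFun s := s.mulRight
  map_add' s t := by
    refine ContinuousLinearMap.coeFn_injective
      ((denseRange_simpleToLInfty m).equalizer (map_continuous _) (map_continuous _) ?_)
    funext φ
    simp only [Function.comp_apply, _root_.add_apply, mulRight_simple]
    rw [← UniformSpace.Completion.coe_add]
    congr 1
    exact LinearMap.congr_fun (simpleMulₗ.map_add s t) φ
  map_smul' c s := by
    refine ContinuousLinearMap.coeFn_injective
      ((denseRange_simpleToLInfty m).equalizer (map_continuous _) (map_continuous _) ?_)
    funext φ
    simp only [Function.comp_apply, _root_.smul_apply, mulRight_simple,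
      RingHom.id_apply]
    rw [← UniformSpace.Completion.coe_smul]
    congr 1
    exact LinearMap.congr_fun (simpleMulₗ.map_smul c s) φ

/-- The multiplication `(ω, g) ↦ g ω` of elements of `Lᵖ(T*X)` by elements of `L^∞(m)`. -/
def cotangentMul : Cotangent m p →L[ℝ] Lp ℝ ∞ m →L[ℝ] Cotangent m p :=
  PreCotangent.mulRightₗ.extendOfNorm PreCotangent.incl

/-- The `L^∞(m)`-module structure of `Lᵖ(T*X)`. -/
instance : SMul (Lp ℝ ∞ m) (Cotangent m p) := ⟨fun g ω => cotangentMul ω g⟩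

theorem denseRange_incl : DenseRange (PreCotangent.incl : PreCotangent m p → Cotangent m p) :=
  UniformSpace.Completion.denseRange_coe

theorem simpleToLInfty_smul_coe (φ : SimpleFunc X ℝ) (s : PreCotangent m p) :
    simpleToLInfty m φ • (s : Cotangent m p) = (PreCotangent.simpleMul φ s : Cotangent m p) := by
  have h : cotangentMul (s : Cotangent m p) = s.mulRight :=
    LinearMap.extendOfNorm_eq (f := PreCotangent.mulRightₗ) (e := PreCotangent.incl)
      denseRange_incl ⟨1, fun t => by
        rw [one_mul]
        exact (PreCotangent.norm_mulRight_le t).trans_eq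
          (UniformSpace.Completion.norm_coe t).symm⟩ s
  change cotangentMul (s : Cotangent m p) (simpleToLInfty m φ) = _
  rw [h, PreCotangent.mulRight_simple]

end Cotangent

/-! ### The tangent module and gradients -/

section Tangent

variable {X : Type*} [MetricSpace X] [MeasurableSpace X]

/-- The tangent module `L^q(TX)`, `1/p + 1/q = 1`: the module dual of `Lᵖ(T*X)`, consisting of all
`L^∞(m)`-linear continuous maps `v : Lᵖ(T*X) → L¹(m)`. We write `v ω` for the pairing `ω(v)`. -/
structure Tangent (m : Measure X) (p : ℝ) [Fact (1 ≤ p)] [SigmaFinite m] where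
  toCLM : Cotangent m p →L[ℝ] Lp ℝ 1 m
  map_smul' : ∀ (g : Lp ℝ ∞ m) (ω : Cotangent m p), toCLM (g • ω) = (g • toCLM ω : Lp ℝ 1 m)

variable {m : Measure X} {p : ℝ} [Fact (1 ≤ p)] [SigmaFinite m]

namespace Tangent

instance : CoeFun (Tangent m p) fun _ => Cotangent m p → Lp ℝ 1 m := ⟨fun v => v.toCLM⟩

/-- The pointwise norm `|v| = ⋁ {ω(v) : ω ∈ Lᵖ(T*X), |ω| ≤ 1}`, a supremum in the lattice of
`m`-a.e. classes. As `ω = 0` is admissible, only the positive parts of the `ω(v)` matter. -/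
def pointwiseNorm (v : Tangent m p) : X →ₘ[m] ℝ≥0∞ :=
  latticeSup m {G | ∃ ω : Cotangent m p, (∀ᵐ x ∂m, cotangentNorm ω x ≤ 1) ∧
    G =ᵐ[m] fun x => ENNReal.ofReal (v ω x)}

end Tangent

/-- The power `a ↦ a^{p/q}`, with the convention that, for `q = ∞`, it is `1` if `a > 0` and `0` if
`a = 0`. -/
def gradPow (p : ℝ) (q : ℝ≥0∞) (a : ℝ) : ℝ := if a = 0 then 0 else a ^ (p / q.toReal)

/-- The set `Grad_q(F)` of all `q`-gradients of `F`: the vector fields `v` such that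
`dF(v) = |DF|ᵖ` and `|v| = |DF|^{p/q}`. -/
def Grad (q : ℝ≥0∞) (F : Dirichlet m p) : Set (Tangent m p) :=
  {v | (v (differential F) =ᵐ[m] fun x => gradNorm F x ^ p) ∧
    v.pointwiseNorm =ᵐ[m] fun x => ENNReal.ofReal (gradPow p q (gradNorm F x))}

end Tangent

/-! ### Boundedly-finite signed Borel measures -/

/-- A boundedly-finite signed Borel measure: a real-valued function `μ` on the bounded Borel sets
such that `E ↦ μ(E ∩ B)` is a finite signed Borel measure for every bounded Borel set `B`. -/
structure BFSignedMeasure (X : Type*) [MetricSpace X] [MeasurableSpace X] where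
  toFun : {B : Set X // MeasurableSet B ∧ Bornology.IsBounded B} → ℝ
  exists_restrict : ∀ B : {B : Set X // MeasurableSet B ∧ Bornology.IsBounded B},
    ∃ ν : SignedMeasure X, ∀ (E : Set X) (hE : MeasurableSet E),
      ν E = toFun ⟨E ∩ B, hE.inter B.2.1, B.2.2.subset inter_subset_right⟩

namespace BFSignedMeasure

variable {X : Type*} [MetricSpace X] [MeasurableSpace X] (μ : BFSignedMeasure X)

/-- The finite signed measure `μ_B(E) = μ(E ∩ B)`. -/
def restrict (B : {B : Set X // MeasurableSet B ∧ Bornology.IsBounded B}) : SignedMeasure X :=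
  Classical.choose (μ.exists_restrict B)

theorem restrict_apply (B : {B : Set X // MeasurableSet B ∧ Bornology.IsBounded B}) {E : Set X}
    (hE : MeasurableSet E) :
    μ.restrict B E = μ.toFun ⟨E ∩ B, hE.inter B.2.1, B.2.2.subset inter_subset_right⟩ :=
  Classical.choose_spec (μ.exists_restrict B) E hE

/-- The opposite measure `-μ`. -/
instance : Neg (BFSignedMeasure X) where
  neg μ :=
    { toFun := fun B => -μ.toFun B
      exists_restrict := fun B => ⟨-μ.restrict B, fun E hE => by
        rw [_root_.neg_apply, restrict_apply μ B hE]⟩ }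

/-- The positive part `μ⁺`, the nonnegative Borel measure that is glued from the positive parts
`(μ_B)⁺` of the restrictions of `μ` to bounded Borel sets `B`. -/
def posPart : Measure X :=
  ⨆ B : {B : Set X // MeasurableSet B ∧ Bornology.IsBounded B},
    (μ.restrict B).toJordanDecomposition.posPart

/-- The negative part `μ⁻ = (-μ)⁺`. -/
def negPart : Measure X := (-μ).posPart

theorem posPart_restrict_le (B B' : {B : Set X // MeasurableSet B ∧ Bornology.IsBounded B})
    {F : Set X} (hF : MeasurableSet F) (hFB : F ⊆ B) :
    (μ.restrict B').toJordanDecomposition.posPart F ≤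
      (μ.restrict B).toJordanDecomposition.posPart F := by
  obtain ⟨i, hi, hi0, -, hpos, -⟩ := (μ.restrict B').toJordanDecomposition_spec
  set j := (μ.restrict B).toJordanDecomposition with hj
  have h1 : (μ.restrict B').toJordanDecomposition.posPart.real F = μ.restrict B' (i ∩ F) := by
    rw [hpos, measureReal_def, SignedMeasure.toMeasureOfZeroLE_apply _ hi0 hi hF]
    rfl
  have h2 : μ.restrict B' (i ∩ F) = μ.restrict B (i ∩ F ∩ B') := by
    rw [restrict_apply _ _ (hi.inter hF), restrict_apply _ _ ((hi.inter hF).inter B'.2.1)]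
    congr 2
    rw [eq_comm, inter_eq_left]
    exact fun x hx => hFB hx.1.2
  have h3 : ∀ G, MeasurableSet G → μ.restrict B G ≤ j.posPart.real G := fun G hG => by
    have := (μ.restrict B).toSignedMeasure_toJordanDecomposition
    rw [← this, JordanDecomposition.toSignedMeasure, _root_.sub_apply,
      Measure.toSignedMeasure_apply_measurable hG, Measure.toSignedMeasure_apply_measurable hG]
    exact sub_le_self _ measureReal_nonneg
  have h4 : (μ.restrict B').toJordanDecomposition.posPart.real F ≤ j.posPart.real F := by
    rw [h1, h2]
    exact (h3 _ ((hi.inter hF).inter B'.2.1)).trans (measureReal_mono fun x hx => hx.1.2)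
  exact (ENNReal.toReal_le_toReal (measure_ne_top _ _) (measure_ne_top _ _)).1 h4

theorem posPart_apply (B : {B : Set X // MeasurableSet B ∧ Bornology.IsBounded B}) {E : Set X}
    (hE : MeasurableSet E) (hEB : E ⊆ B) :
    μ.posPart E = (μ.restrict B).toJordanDecomposition.posPart E := by
  set ν := (μ.restrict B).toJordanDecomposition.posPart with hν
  refine le_antisymm ?_ ((le_iSup (fun B => (μ.restrict B).toJordanDecomposition.posPart) B) E)
  have h : μ.posPart ≤ ν.restrict E + (⊤ : Measure X).restrict Eᶜ := by
    refine iSup_le fun B' => ?_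
    rw [← Measure.restrict_add_restrict_compl (μ := (μ.restrict B').toJordanDecomposition.posPart)
      hE]
    refine add_le_add (Measure.le_iff.2 fun G hG => ?_) (Measure.restrict_mono_measure le_top _)
    rw [Measure.restrict_apply hG, Measure.restrict_apply hG]
    exact μ.posPart_restrict_le B B' (hG.inter hE) (inter_subset_right.trans hEB)
  refine (h E).trans ?_
  rw [Measure.add_apply, Measure.restrict_apply_self, Measure.restrict_apply hE, inter_compl_self,
    measure_empty, add_zero]

/-- The integral `∫ f dμ = ∫ f dμ⁺ - ∫ f dμ⁻`. -/
def integral (f : X → ℝ) : ℝ := ∫ x, f x ∂μ.posPart - ∫ x, f x ∂μ.negPart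

end BFSignedMeasure

/-! ### Divergence and Laplacian -/

section Laplacian

variable {X : Type*} [MetricSpace X] [SecondCountableTopology X] [MeasurableSpace X] [BorelSpace X]
variable {m : Measure X} [BoundedlyFinite m] {p : ℝ} [Fact (1 ≤ p)]

/-- The measure `μ` is the `q`-divergence of the vector field `v`. -/
def IsDivergence (v : Tangent m p) (μ : BFSignedMeasure X) : Prop :=
  ∀ ψ : LipBS X, ∫ x, v (differential (ψ.toDirichlet m p)) x ∂m = -μ.integral ψ.toFun

/-- The set `Δ_p(F)` of all `p`-Laplacians of the Dirichlet function `F`. -/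
def laplacian (F : Dirichlet m p) : Set (BFSignedMeasure X) :=
  {μ | ∀ ψ : LipBS X, -μ.integral ψ.toFun ≤
    ∫ x in {x | 0 < gradNorm F x},
      (gradNorm (F + ψ.toDirichlet m p) x ^ p - gradNorm F x ^ p) / p ∂m}

end Laplacian

end MetricSobolev

end

/-! Up to sign, a `p`-Laplacian of `f` is a subgradient at `0` of the convex functional `ψ ↦ (1/p) ∫
|D(f + ψ)|^p` over `{|Df| > 0}`, and the theorem identifies these subgradients by duality. Write `A
= |Df|` and `b = A^{p/q}`, so that `A b = A^p`, and `b = 0` where `A = 0`.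

Gradients give Laplacians (`mem_laplacian_of_isDivergence`): if `v` is a gradient with divergence
`μ`, then on `{A > 0}` one has `dψ(v) = d(f + ψ)(v) - df(v) ≤ |D(f + ψ)| A^{p-1} - A^p`, which the
tangent line of `t ↦ t^p` at `A` bounds by `(|D(f + ψ)|^p - A^p) / p`. On `{A = 0}` the field `v`
vanishes. It remains to integrate.

Laplacians give gradients (`exists_grad_isDivergence_of_mem_laplacian`): testing with `tψ`, writing
`f + tψ = (1 - ta) f + t (af + ψ)` and letting `t → 0+` shows that the functional `a df + dψ ↦ a ∫
A^p dm - ∫ ψ dμ` is dominated by `ω ↦ ∫ |ω| b dm` (`sub_integral_le_of_mem_laplacian`). Hahn–Banach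
extends it to the whole cotangent module with the same domination, and Radon–Nikodym, applied to `E
↦ L(1_E ω)` for each `ω`, represents the extension as `ω ↦ ∫ ω(w) dm` with `|w| ≤ b`
(`exists_tangent_of_le`). Its values on the `dψ` say that `w` has divergence `μ`. Its value on `df`
is `∫ A^p dm`, the largest that the domination allows, so `df(w) ≤ A b = A^p` is an equality a.e.,
and this forces `|w| = b`. -/

noncomputable section

namespace MetricSobolev

/-! ### A Riesz-type representation of dominated additive set functions -/

section SetFunction

variable {α : Type*} [MeasurableSpace α]

open Classical in
/-- An additive set function dominated by an integrable density has a density itself. -/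
theorem exists_density_of_additive_of_le {μ : Measure α} [SigmaFinite μ] {h : α → ℝ}
    (hi : Integrable h μ) (h0 : 0 ≤ᵐ[μ] h) {s : Set α → ℝ}
    (hs : ∀ E, MeasurableSet E → |s E| ≤ ∫ x in E, h x ∂μ)
    (hadd : ∀ E F, MeasurableSet E → MeasurableSet F → Disjoint E F → s (E ∪ F) = s E + s F) :
    ∃ g, Integrable g μ ∧ ∀ E, MeasurableSet E → ∫ x in E, g x ∂μ = s E := by
  set ν := μ.withDensity fun x => ENNReal.ofReal (h x) with hν
  have : IsFiniteMeasure ν := isFiniteMeasure_withDensity_ofReal hi.2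
  have hνE : ∀ E, MeasurableSet E → ν E = ENNReal.ofReal (∫ x in E, h x ∂μ) := fun E hE => by
    rw [hν, withDensity_apply _ hE, ofReal_integral_eq_lintegral_ofReal hi.integrableOn
      (ae_restrict_of_ae h0)]
  -- Finite additivity upgrades to countable additivity because the tails of a disjoint union have
  -- small `ν`-mass, `ν` being finite. Vector measures have to vanish off the measurable sets, hence
  -- the `if`.
  let S : SignedMeasure α := VectorMeasure.of_additive_of_le_measure (μ := ν)
    (fun E => if MeasurableSet E then s E else 0)
    (fun E => by
      by_cases hE : MeasurableSet E
      · simp only [hE, if_true]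
        rw [hνE E hE, Real.enorm_eq_ofReal_abs]
        exact ENNReal.ofReal_le_ofReal (hs E hE)
      · simp [hE])
    (fun E F hE hF hd => by simp [hE, hF, hE.union hF, hadd E F hE hF hd])
    (fun E hE => by simp [hE])
  have hS : ∀ E, MeasurableSet E → S E = s E := fun E hE => if_pos hE
  have hac : S ≪ᵥ μ.toENNRealVectorMeasure := by
    refine VectorMeasure.AbsolutelyContinuous.mk fun E hE h0 => ?_
    rw [Measure.toENNRealVectorMeasure_apply_measurable hE] at h0
    rw [hS E hE, ← abs_nonpos_iff]
    refine (hs E hE).trans_eq ?_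
    rw [Measure.restrict_eq_zero.2 h0, integral_zero_measure]
  refine ⟨S.rnDeriv μ, SignedMeasure.integrable_rnDeriv S μ, fun E hE => ?_⟩
  rw [← hS E hE, ← withDensityᵥ_apply (SignedMeasure.integrable_rnDeriv S μ) hE,
    SignedMeasure.withDensityᵥ_rnDeriv_eq S μ hac]

theorem ae_abs_le_of_forall_setIntegral_le {μ : Measure α} {g h : α → ℝ}
    (hg : Integrable g μ) (hh : Integrable h μ)
    (H : ∀ E, MeasurableSet E → |∫ x in E, g x ∂μ| ≤ ∫ x in E, h x ∂μ) :
    ∀ᵐ x ∂μ, |g x| ≤ h x := by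
  have h1 : g ≤ᵐ[μ] h := ae_le_of_forall_setIntegral_le hg hh fun E hE _ =>
    (le_abs_self _).trans (H E hE)
  have h2 : -g ≤ᵐ[μ] h := ae_le_of_forall_setIntegral_le hg.neg hh fun E hE _ => by
    simp only [Pi.neg_apply]
    rw [integral_neg]
    exact (neg_le_abs _).trans (H E hE)
  filter_upwards [h1, h2] with x a b
  exact abs_le.2 ⟨by simp only [Pi.neg_apply] at b; linarith, a⟩

end SetFunction

/-! ### A Hahn–Banach extension along a linear map -/

/-- The map `T` need not be injective: in the application distinct pairs `(a, ψ)` may give the same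
`a df + dψ`. Domination alone makes `l` descend to the range of `T`, since on `ker T` both `l v` and
`l (-v)` are at most `N 0 = 0`. The usual extension theorem then applies. -/
theorem exists_linear_extension_of_le_sublinear {V E : Type*} [AddCommGroup V] [Module ℝ V]
    [AddCommGroup E] [Module ℝ E] (T : V →ₗ[ℝ] E) (l : V →ₗ[ℝ] ℝ) (N : E → ℝ)
    (N_hom : ∀ c : ℝ, 0 < c → ∀ x, N (c • x) = c * N x)
    (N_add : ∀ x y, N (x + y) ≤ N x + N y) (hl : ∀ v, l v ≤ N (T v)) :
    ∃ L : E →ₗ[ℝ] ℝ, (∀ v, L (T v) = l v) ∧ ∀ x, L x ≤ N x := by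
  -- Homogeneity is only assumed for positive scalars, so `N 0 = 0` is read off from `N (2 • 0) = 2
  -- * N 0`.
  have N0 : N 0 = 0 := by
    have := N_hom 2 two_pos 0
    rw [smul_zero] at this
    linarith
  have hker : LinearMap.ker T ≤ LinearMap.ker l := by
    intro v hv
    rw [LinearMap.mem_ker] at hv ⊢
    have h1 := hl v
    have h2 := hl (-v)
    rw [map_neg, map_neg, hv, neg_zero, N0] at h2
    rw [hv, N0] at h1
    linarith
  let f : E →ₗ.[ℝ] ℝ :=
    ⟨LinearMap.range T, (LinearMap.ker T).liftQ l hker ∘ₗ T.quotKerEquivRange.symm.toLinearMap⟩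
  have hf : ∀ v, f ⟨T v, LinearMap.mem_range_self T v⟩ = l v := by
    intro v
    change (LinearMap.ker T).liftQ l hker (T.quotKerEquivRange.symm _) = l v
    have : T.quotKerEquivRange.symm ⟨T v, LinearMap.mem_range_self T v⟩ =
        (LinearMap.ker T).mkQ v := T.quotKerEquivRange_symm_apply_image v _
    rw [this]; simp
  obtain ⟨L, hL, hLN⟩ := exists_extension_of_le_sublinear f N N_hom N_add (by
    rintro ⟨_, v, rfl⟩
    exact (hf v).trans_le (hl v))
  exact ⟨L, fun v => (hL ⟨T v, LinearMap.mem_range_self T v⟩).trans (hf v), hLN⟩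

/-! ### The pointwise norm on the cotangent module -/

section CotangentNorm

variable {X : Type*} [MetricSpace X] [MeasurableSpace X]
variable {m : Measure X} {p : ℝ} [Fact (1 ≤ p)] [SigmaFinite m]

/-- Continuity makes the properties of the pointwise norm below closed conditions, so that they need
only be checked on the dense pre-cotangent module, where they are pointwise facts about minimal weak
upper gradients. -/
theorem continuous_cotangentNorm :
    Continuous (cotangentNorm : Cotangent m p → Lp ℝ (ENNReal.ofReal p) m) :=
  UniformSpace.Completion.continuous_extension

theorem norm_cotangentNorm (ω : Cotangent m p) : ‖cotangentNorm ω‖ = ‖ω‖ := by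
  induction ω using UniformSpace.Completion.induction_on with
  | hp => exact isClosed_eq continuous_cotangentNorm.norm continuous_norm
  | ih s => rw [cotangentNorm_coe, UniformSpace.Completion.norm_coe]; rfl

theorem cotangentNorm_nonneg (ω : Cotangent m p) : 0 ≤ cotangentNorm ω := by
  induction ω using UniformSpace.Completion.induction_on with
  | hp => exact isClosed_le continuous_const continuous_cotangentNorm
  | ih s =>
    rw [cotangentNorm_coe, ← Lp.coeFn_nonneg]
    exact s.pointwiseNorm_nonneg

theorem ae_cotangentNorm_nonneg (ω : Cotangent m p) : ∀ᵐ x ∂m, 0 ≤ cotangentNorm ω x :=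
  (Lp.coeFn_nonneg _).2 (cotangentNorm_nonneg ω)

theorem cotangentNorm_add_le (ω η : Cotangent m p) :
    cotangentNorm (ω + η) ≤ cotangentNorm ω + cotangentNorm η := by
  induction ω, η using UniformSpace.Completion.induction_on₂ with
  | hp =>
    exact isClosed_le (continuous_cotangentNorm.comp (continuous_fst.add continuous_snd))
      ((continuous_cotangentNorm.comp continuous_fst).add
        (continuous_cotangentNorm.comp continuous_snd))
  | ih s t =>
    rw [← UniformSpace.Completion.coe_add]
    simp only [cotangentNorm_coe]
    rw [← Lp.coeFn_le]
    filter_upwards [PreCotangent.pointwiseNorm_add_le s t,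
      Lp.coeFn_add (PreCotangent.pointwiseNorm s) (PreCotangent.pointwiseNorm t)] with x h1 h2
    rw [h2]
    exact h1

theorem ae_cotangentNorm_add_le (ω η : Cotangent m p) :
    ∀ᵐ x ∂m, cotangentNorm (ω + η) x ≤ cotangentNorm ω x + cotangentNorm η x := by
  filter_upwards [(Lp.coeFn_le _ _).2 (cotangentNorm_add_le ω η), Lp.coeFn_add (cotangentNorm ω)
    (cotangentNorm η)] with x h1 h2
  rw [h2] at h1
  exact h1

theorem cotangentNorm_smul (c : ℝ) (ω : Cotangent m p) :
    cotangentNorm (c • ω) = |c| • cotangentNorm ω := by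
  induction ω using UniformSpace.Completion.induction_on with
  | hp =>
    exact isClosed_eq (continuous_cotangentNorm.comp (continuous_const_smul c))
      (continuous_cotangentNorm.const_smul |c|)
  | ih s =>
    rw [← UniformSpace.Completion.coe_smul]
    simp only [cotangentNorm_coe]
    refine Lp.ext ?_
    filter_upwards [PreCotangent.pointwiseNorm_smul c s,
      Lp.coeFn_smul |c| (PreCotangent.pointwiseNorm s)] with x h1 h2
    rw [h1, h2]
    rfl

theorem continuous_smul_cotangent (g : Lp ℝ ∞ m) :
    Continuous fun ω : Cotangent m p => g • ω :=
  (cotangentMul.flip g).continuous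

theorem cotangentNorm_simple_smul (φ : SimpleFunc X ℝ) (ω : Cotangent m p) :
    ∀ᵐ x ∂m, cotangentNorm (simpleToLInfty m φ • ω) x = |φ x| * cotangentNorm ω x := by
  -- To be a closed condition in `ω`, the a.e. identity is recast as an equality in `Lᵖ`, with `|φ|`
  -- acting by the continuous Hölder product `L^∞ × Lᵖ → Lᵖ`.
  have key : cotangentNorm (simpleToLInfty m φ • ω) =
      (ContinuousLinearMap.mul ℝ ℝ).holderL m ∞ (ENNReal.ofReal p) (ENNReal.ofReal p)
        (simpleToLInfty m (φ.map abs)) (cotangentNorm ω) := by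
    induction ω using UniformSpace.Completion.induction_on with
    | hp =>
      exact isClosed_eq (continuous_cotangentNorm.comp (continuous_smul_cotangent _))
        ((ContinuousLinearMap.continuous _).comp continuous_cotangentNorm)
    | ih s =>
      rw [simpleToLInfty_smul_coe]
      simp only [cotangentNorm_coe]
      refine Lp.ext ?_
      filter_upwards [PreCotangent.pointwiseNorm_simpleMul φ s,
        coeFn_simpleToLInfty (m := m) (φ.map abs),
        (ContinuousLinearMap.mul ℝ ℝ).coeFn_holder (r := ENNReal.ofReal p)
          (simpleToLInfty m (φ.map abs)) (PreCotangent.pointwiseNorm s)] with x h1 h2 h3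
      rw [h1]
      rw [ContinuousLinearMap.holderL_apply_apply, h3, h2]
      rfl
  rw [key]
  filter_upwards [coeFn_simpleToLInfty (m := m) (φ.map abs),
    (ContinuousLinearMap.mul ℝ ℝ).coeFn_holder (r := ENNReal.ofReal p)
      (simpleToLInfty m (φ.map abs)) (cotangentNorm ω)] with x h2 h3
  rw [ContinuousLinearMap.holderL_apply_apply, h3, h2]
  rfl

/-- Associativity for simple coefficients is enough: the `L^∞`-linearity of the field built in
`exists_tangent_of_le` is verified for them and passes to the limit by density. -/
theorem simple_mul_smul (φ φ' : SimpleFunc X ℝ) (ω : Cotangent m p) :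
    simpleToLInfty m (φ * φ') • ω = simpleToLInfty m φ • simpleToLInfty m φ' • ω := by
  induction ω using UniformSpace.Completion.induction_on with
  | hp =>
    exact isClosed_eq (continuous_smul_cotangent _)
      ((continuous_smul_cotangent _).comp (continuous_smul_cotangent _))
  | ih s =>
    simp only [simpleToLInfty_smul_coe]
    congr 1
    exact PreCotangent.ext' fun x => by
      simp only [PreCotangent.simpleMul_apply, SimpleFunc.coe_mul, Pi.mul_apply, mul_smul]

theorem simple_add_smul (φ φ' : SimpleFunc X ℝ) (ω : Cotangent m p) :
    simpleToLInfty m (φ + φ') • ω = simpleToLInfty m φ • ω + simpleToLInfty m φ' • ω := by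
  change cotangentMul ω _ = cotangentMul ω _ + cotangentMul ω _
  rw [map_add, map_add]

theorem simple_const_smul (c : ℝ) (ω : Cotangent m p) :
    simpleToLInfty m (SimpleFunc.const X c) • ω = c • ω := by
  induction ω using UniformSpace.Completion.induction_on with
  | hp => exact isClosed_eq (continuous_smul_cotangent _) (continuous_const_smul c)
  | ih s =>
    rw [simpleToLInfty_smul_coe, ← UniformSpace.Completion.coe_smul]
    rfl

theorem smul_cotangent_add (g : Lp ℝ ∞ m) (ω η : Cotangent m p) :
    g • (ω + η) = g • ω + g • η :=
  map_add (cotangentMul.flip g) ω η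

theorem smul_cotangent_smul (g : Lp ℝ ∞ m) (c : ℝ) (ω : Cotangent m p) :
    g • (c • ω) = c • (g • ω) :=
  map_smul (cotangentMul.flip g) c ω

end CotangentNorm

/-! ### Vector fields represented by linear functionals on the cotangent module -/

section SimpleFunctions

variable {X : Type*} [MeasurableSpace X]

/-- The indicator function of a set as a simple function (zero if the set is not measurable). -/
def indicatorSimple (E : Set X) : SimpleFunc X ℝ := (SimpleFunc.const X (1 : ℝ)).restrict E

theorem indicatorSimple_apply {E : Set X} (hE : MeasurableSet E) (x : X) :
    indicatorSimple E x = E.indicator (fun _ => 1) x := by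
  rw [indicatorSimple, SimpleFunc.restrict_apply _ hE]
  rfl

theorem indicatorSimple_univ : indicatorSimple (univ : Set X) = SimpleFunc.const X 1 :=
  SimpleFunc.restrict_univ _

theorem indicatorSimple_union {E F : Set X} (hE : MeasurableSet E) (hF : MeasurableSet F)
    (hd : Disjoint E F) : indicatorSimple (E ∪ F) = indicatorSimple E + indicatorSimple F := by
  ext x
  rw [SimpleFunc.coe_add, Pi.add_apply, indicatorSimple_apply hE, indicatorSimple_apply hF,
    indicatorSimple_apply (hE.union hF), indicator_union_of_disjoint hd]

variable {m : Measure X}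

theorem lp_one_ext_of_setIntegral_eq {g g' : Lp ℝ 1 m}
    (h : ∀ E, MeasurableSet E → ∫ x in E, g x ∂m = ∫ x in E, g' x ∂m) : g = g' :=
  Lp.ext (Integrable.ae_eq_of_forall_setIntegral_eq _ _ (L1.integrable_coeFn g)
    (L1.integrable_coeFn g') fun E hE _ => h E hE)

theorem coeFn_simple_smul_lp_one (φ : SimpleFunc X ℝ) (g : Lp ℝ 1 m) :
    (simpleToLInfty m φ • g : Lp ℝ 1 m) =ᵐ[m] fun x => φ x * g x := by
  filter_upwards [Lp.coeFn_lpSMul (r := 1) (simpleToLInfty m φ) g, coeFn_simpleToLInfty φ]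
    with x h1 h2
  rw [h1, Pi.smul_apply', h2, smul_eq_mul]

end SimpleFunctions

/-! ### Representation of dominated functionals, and duality of the pointwise norms -/

section Representation

variable {X : Type*} [MetricSpace X] [MeasurableSpace X]
variable {m : Measure X} {p : ℝ} [Fact (1 ≤ p)] [SigmaFinite m]

theorem integrable_cotangentNorm_mul {q : ℝ≥0∞} [ENNReal.HolderConjugate (ENNReal.ofReal p) q]
    (ω : Cotangent m p) (b : Lp ℝ q m) : Integrable (fun x => cotangentNorm ω x * b x) m :=
  (Lp.memLp (cotangentNorm ω)).integrable_mul (Lp.memLp b)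

/-- Hölder's inequality together with `‖|ω|‖ = ‖ω‖`. It turns the pointwise bound by `|ω| b` into
continuity of the constructed field as a map into `L¹`. -/
theorem exists_integral_cotangentNorm_mul_le {q : ℝ≥0∞}
    [hq : ENNReal.HolderConjugate (ENNReal.ofReal p) q] (b : Lp ℝ q m) :
    ∃ C, ∀ ω : Cotangent m p, ∫ x, cotangentNorm ω x * b x ∂m ≤ C * ‖ω‖ := by
  have : Fact (1 ≤ q) := ⟨hq.symm.one_le⟩
  refine ⟨‖((ContinuousLinearMap.mul ℝ ℝ).lpPairing m (ENNReal.ofReal p) q).flip b‖, fun ω => ?_⟩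
  have h := (((ContinuousLinearMap.mul ℝ ℝ).lpPairing m (ENNReal.ofReal p) q).flip b).le_opNorm
    (cotangentNorm ω)
  rw [norm_cotangentNorm, ContinuousLinearMap.flip_apply,
    ContinuousLinearMap.lpPairing_eq_integral] at h
  exact (le_abs_self _).trans h

theorem cotangentNorm_indicator_smul {E : Set X} (hE : MeasurableSet E) (ω : Cotangent m p) :
    cotangentNorm (simpleToLInfty m (indicatorSimple E) • ω) =ᵐ[m]
      E.indicator (cotangentNorm ω) := by
  filter_upwards [cotangentNorm_simple_smul (indicatorSimple E) ω] with x hx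
  rw [hx, indicatorSimple_apply hE]
  by_cases h : x ∈ E <;> simp [h]

/-- A linear functional on the cotangent module that is dominated by `ω ↦ ∫ |ω| b dm`, with
`b ∈ L^q(m)⁺`, is the integral of the pairing with a vector field of pointwise norm at most `b`. -/
theorem exists_tangent_of_le {q : ℝ≥0∞} [ENNReal.HolderConjugate (ENNReal.ofReal p) q]
    (L : Cotangent m p →ₗ[ℝ] ℝ) (b : Lp ℝ q m) (hb : 0 ≤ᵐ[m] b)
    (hL : ∀ ω, L ω ≤ ∫ x, cotangentNorm ω x * b x ∂m) :
    ∃ w : Tangent m p, (∀ ω, ∫ x, w ω x ∂m = L ω) ∧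
      ∀ ω, ∀ᵐ x ∂m, |w ω x| ≤ cotangentNorm ω x * b x := by
  have hint : ∀ ω : Cotangent m p, Integrable (fun x => cotangentNorm ω x * b x) m :=
    fun ω => integrable_cotangentNorm_mul ω b
  have hpos : ∀ ω : Cotangent m p, 0 ≤ᵐ[m] fun x => cotangentNorm ω x * b x := fun ω => by
    filter_upwards [hb, ae_cotangentNorm_nonneg ω] with x h1 h2
    exact mul_nonneg h2 h1
  -- The dominating functional is even, so the one-sided bound applied to `-ω` is the other half.
  have habs : ∀ ω, |L ω| ≤ ∫ x, cotangentNorm ω x * b x ∂m := by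
    refine fun ω => abs_le.2 ⟨?_, hL ω⟩
    have h1 := hL ((-1 : ℝ) • ω)
    rw [cotangentNorm_smul, abs_neg, abs_one, one_smul, map_smul, smul_eq_mul] at h1
    linarith
  have hset : ∀ ω E, MeasurableSet E →
      |L (simpleToLInfty m (indicatorSimple E) • ω)| ≤ ∫ x in E, cotangentNorm ω x * b x ∂m := by
    intro ω E hE
    refine (habs _).trans_eq ?_
    rw [← integral_indicator hE]
    refine integral_congr_ae ?_
    filter_upwards [cotangentNorm_indicator_smul hE ω] with x hx
    rw [hx]
    by_cases h : x ∈ E <;> simp [h]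
  -- The future `ω(w)` is the density of the set function `E ↦ L(1_E ω)`. Linearity in `ω` and the
  -- behaviour under multiplication then follow from uniqueness of densities.
  have hex : ∀ ω, ∃ g : Lp ℝ 1 m, ∀ E, MeasurableSet E →
      ∫ x in E, g x ∂m = L (simpleToLInfty m (indicatorSimple E) • ω) := by
    intro ω
    obtain ⟨g, hg, hgE⟩ := exists_density_of_additive_of_le (hint ω) (hpos ω) (hset ω)
      (fun E F hE hF hd => by rw [indicatorSimple_union hE hF hd, simple_add_smul, map_add])
    refine ⟨hg.toL1 g, fun E hE => ?_⟩
    rw [← hgE E hE]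
    exact integral_congr_ae (ae_restrict_of_ae hg.coeFn_toL1)
  choose W hW using hex
  have hWi : ∀ ω, Integrable (W ω) m := fun ω => L1.integrable_coeFn (W ω)
  have hWb : ∀ ω, ∀ᵐ x ∂m, |W ω x| ≤ cotangentNorm ω x * b x := fun ω =>
    ae_abs_le_of_forall_setIntegral_le (hWi ω) (hint ω) fun E hE =>
      (hW ω E hE).symm ▸ hset ω E hE
  let Wₗ : Cotangent m p →ₗ[ℝ] Lp ℝ 1 m :=
    { toFun := W
      map_add' := fun ω η => lp_one_ext_of_setIntegral_eq fun E hE => by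
        rw [integral_congr_ae (ae_restrict_of_ae (Lp.coeFn_add (W ω) (W η))), hW _ E hE,
          smul_cotangent_add, map_add, ← hW _ E hE, ← hW _ E hE]
        exact (integral_add (hWi ω).integrableOn (hWi η).integrableOn).symm
      map_smul' := fun c ω => lp_one_ext_of_setIntegral_eq fun E hE => by
        rw [integral_congr_ae (ae_restrict_of_ae (Lp.coeFn_smul ((RingHom.id ℝ) c) (W ω))),
          hW _ E hE, smul_cotangent_smul, map_smul, ← hW _ E hE]
        exact (integral_const_mul c _).symm }
  obtain ⟨C, hC⟩ := exists_integral_cotangentNorm_mul_le (p := p) b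
  let Wc : Cotangent m p →L[ℝ] Lp ℝ 1 m := Wₗ.mkContinuous C fun ω => by
    refine le_trans ?_ (hC ω)
    rw [L1.norm_eq_integral_norm]
    exact integral_mono_ae (hWi ω).norm (hint ω) (hWb ω)
  -- For the coefficient `c 1_F` this compares densities through `1_E · c 1_F = c 1_{E ∩ F}`. Sums
  -- of such functions exhaust the simple functions.
  have hind : ∀ (c : ℝ) (F : Set X) (hF : MeasurableSet F) (ω : Cotangent m p),
      W (simpleToLInfty m (SimpleFunc.piecewise F hF (SimpleFunc.const X c)
        (SimpleFunc.const X 0)) • ω) =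
      simpleToLInfty m (SimpleFunc.piecewise F hF (SimpleFunc.const X c)
        (SimpleFunc.const X 0)) • W ω := by
    intro c F hF ω
    refine lp_one_ext_of_setIntegral_eq fun E hE => ?_
    have e1 : indicatorSimple E * SimpleFunc.piecewise F hF (SimpleFunc.const X c)
        (SimpleFunc.const X 0) = c • indicatorSimple (E ∩ F) := by
      ext x
      rw [SimpleFunc.coe_mul, Pi.mul_apply, SimpleFunc.coe_smul, Pi.smul_apply,
        indicatorSimple_apply hE, indicatorSimple_apply (hE.inter hF)]
      by_cases h1 : x ∈ E <;> by_cases h2 : x ∈ F <;> simp [h1, h2]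
    have e2 : simpleToLInfty m (c • indicatorSimple (E ∩ F)) • ω =
        c • simpleToLInfty m (indicatorSimple (E ∩ F)) • ω := by
      change cotangentMul ω _ = c • cotangentMul ω _
      rw [map_smul, map_smul]
    rw [hW _ E hE, ← simple_mul_smul, e1, e2, map_smul, ← hW _ _ (hE.inter hF), smul_eq_mul,
      ← integral_const_mul, ← setIntegral_indicator hF]
    refine integral_congr_ae (ae_restrict_of_ae ?_)
    filter_upwards [coeFn_simple_smul_lp_one (SimpleFunc.piecewise F hF (SimpleFunc.const X c)
      (SimpleFunc.const X 0)) (W ω)] with x hx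
    rw [hx]
    by_cases h : x ∈ F <;> simp [h]
  have hsimple : ∀ (φ : SimpleFunc X ℝ) (ω : Cotangent m p),
      W (simpleToLInfty m φ • ω) = simpleToLInfty m φ • W ω := by
    intro φ ω
    induction φ using SimpleFunc.induction with
    | const c hF => exact hind c _ hF ω
    | add _ h1 h2 =>
      rw [simple_add_smul, map_add, Lp.smul_add, ← h1, ← h2]
      exact Wₗ.map_add _ _
  refine ⟨⟨Wc, fun g ω => ?_⟩, fun ω => ?_, hWb⟩
  -- Both sides are continuous in `g ∈ L^∞` and agree on the dense set of simple functions.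
  · refine congrFun ((denseRange_simpleToLInfty m).equalizer
      (g := fun g : Lp ℝ ∞ m => Wc (g • ω))
      (h := fun g : Lp ℝ ∞ m => (g • Wc ω : Lp ℝ 1 m)) ?_ ?_ ?_) g
    · exact Wc.continuous.comp (cotangentMul ω).continuous
    · exact (((ContinuousLinearMap.mul ℝ ℝ).holderL m ∞ 1 1).flip (Wc ω)).continuous
    · funext φ
      exact hsimple φ ω
  · have h := hW ω univ MeasurableSet.univ
    rw [indicatorSimple_univ, simple_const_smul, one_smul, setIntegral_univ] at h
    exact h

/-- The pairing of a cotangent vector field with a tangent vector field is dominated by the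
product of the pointwise norms. -/
theorem Tangent.apply_le_mul_pointwiseNorm (v : Tangent m p) (ω : Cotangent m p) :
    ∀ᵐ x ∂m, v.pointwiseNorm x ≠ ∞ →
      v ω x ≤ cotangentNorm ω x * (v.pointwiseNorm x).toReal := by
  -- The supremum defining `|v|` only sees forms of pointwise norm at most `1`. The competitor `r⁻¹
  -- 1_{|ω| ≤ r} ω` is one of them, and it involves only a simple coefficient.
  have key : ∀ r : ℝ, 0 < r → ∀ᵐ x ∂m, cotangentNorm ω x ≤ r → v.pointwiseNorm x ≠ ∞ →
      v ω x ≤ r * (v.pointwiseNorm x).toReal := by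
    intro r hr
    set F : Set X := {x | cotangentNorm ω x ≤ r} with hFdef
    have hF : MeasurableSet F :=
      measurableSet_le (Lp.stronglyMeasurable _).measurable measurable_const
    set φ : SimpleFunc X ℝ := r⁻¹ • indicatorSimple F with hφ
    have hφx : ∀ x, φ x = F.indicator (fun _ => r⁻¹) x := fun x => by
      rw [hφ, SimpleFunc.coe_smul, Pi.smul_apply, indicatorSimple_apply hF]
      by_cases h : x ∈ F <;> simp [h]
    have hle : ∀ᵐ x ∂m, cotangentNorm (simpleToLInfty m φ • ω) x ≤ 1 := by
      filter_upwards [cotangentNorm_simple_smul φ ω] with x hx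
      rw [hx, hφx]
      by_cases h : x ∈ F
      · rw [indicator_of_mem h, abs_of_pos (inv_pos.2 hr), inv_mul_le_iff₀ hr, mul_one]
        exact h
      · simp [h]
    have hmeas : Measurable fun x => ENNReal.ofReal (v (simpleToLInfty m φ • ω) x) :=
      (Lp.stronglyMeasurable _).measurable.ennreal_ofReal
    have h1 := (isLUB_latticeSup m {G | ∃ ω : Cotangent m p, (∀ᵐ x ∂m, cotangentNorm ω x ≤ 1) ∧
      G =ᵐ[m] fun x => ENNReal.ofReal (v ω x)}).1
      ⟨simpleToLInfty m φ • ω, hle, AEEqFun.coeFn_mk _ hmeas.aestronglyMeasurable⟩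
    have h2 := (AEEqFun.coeFn_mk _ hmeas.aestronglyMeasurable).symm.le.trans (AEEqFun.coeFn_le.2 h1)
    have h3 : v (simpleToLInfty m φ • ω) =ᵐ[m] fun x => φ x * v ω x := by
      rw [v.map_smul']
      exact coeFn_simple_smul_lp_one φ _
    filter_upwards [h2, h3] with x h2 h3 hx hfin
    rw [h3, hφx, indicator_of_mem (show x ∈ F from hx)] at h2
    have h4 := (ENNReal.ofReal_le_iff_le_toReal hfin).1 h2
    rwa [inv_mul_le_iff₀ hr] at h4
  -- Rational `r` leave a single null set, outside which `r` can decrease to `|ω|(x)`.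
  have hall : ∀ᵐ x ∂m, ∀ r : ℚ, 0 < (r : ℝ) → cotangentNorm ω x ≤ r → v.pointwiseNorm x ≠ ∞ →
      v ω x ≤ r * (v.pointwiseNorm x).toReal := by
    rw [ae_all_iff]
    intro r
    by_cases hr : 0 < (r : ℝ)
    · filter_upwards [key r hr] with x hx _ using hx
    · exact Eventually.of_forall fun x h => absurd h hr
  filter_upwards [hall, ae_cotangentNorm_nonneg ω] with x hx h0 hfin
  refine le_of_forall_gt_imp_ge_of_dense fun y hy => ?_
  set B := (v.pointwiseNorm x).toReal
  have hB : 0 ≤ B := ENNReal.toReal_nonneg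
  have hB1 : 0 < B + 1 := by linarith
  -- With `a = |ω|(x)`, the choice gives `(r - a)(B + 1) < y - a B`, hence `r B < y`; the `+ 1`
  -- avoids dividing by zero when `B = 0`.
  obtain ⟨r, hr1, hr2⟩ := exists_rat_btwn
    (show cotangentNorm ω x < cotangentNorm ω x + (y - cotangentNorm ω x * B) / (B + 1) from
      lt_add_of_pos_right _ (div_pos (sub_pos.2 hy) hB1))
  refine (hx r (h0.trans_lt hr1) hr1.le hfin).trans ?_
  set a := cotangentNorm ω x
  have h5 : (r - a) * (B + 1) < y - a * B := by
    rw [← lt_div_iff₀ hB1]; linarith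
  nlinarith

/-- An upper bound for all pairings is an upper bound for the pointwise norm. -/
theorem Tangent.pointwiseNorm_le {v : Tangent m p} {b : X → ℝ} (hb : Measurable b)
    (hb0 : 0 ≤ᵐ[m] b) (h : ∀ ω, ∀ᵐ x ∂m, v ω x ≤ cotangentNorm ω x * b x) :
    v.pointwiseNorm ≤ᵐ[m] fun x => ENNReal.ofReal (b x) := by
  have hm : AEStronglyMeasurable (fun x => ENNReal.ofReal (b x)) m :=
    hb.ennreal_ofReal.aestronglyMeasurable
  have h1 : v.pointwiseNorm ≤ AEEqFun.mk _ hm := by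
    refine (isLUB_latticeSup m _).2 ?_
    rintro G ⟨ω, hω, hG⟩
    rw [← AEEqFun.coeFn_le]
    filter_upwards [hG, hω, h ω, AEEqFun.coeFn_mk _ hm, hb0] with x h1 h2 h3 h4 h5
    rw [h1, h4]
    exact ENNReal.ofReal_le_ofReal (h3.trans (mul_le_of_le_one_left h5 h2))
  exact (AEEqFun.coeFn_le.2 h1).trans (AEEqFun.coeFn_mk _ hm).le

end Representation

/-! ### Convexity of powers and the first variation of the `p`-energy -/

section FirstVariation

/-- Bernoulli's inequality at `y / x - 1`, multiplied by `x ^ p`: the graph of `t ↦ t ^ p` lies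
above its tangent at `x`. -/
theorem rpow_sub_rpow_le {p : ℝ} (hp : 1 ≤ p) {x y : ℝ} (hx : 0 < x) (hy : 0 ≤ y) :
    p * (x ^ (p - 1) * (y - x)) ≤ y ^ p - x ^ p := by
  have h := one_add_mul_self_le_rpow_one_add (s := y / x - 1)
    (by have := div_nonneg hy hx.le; linarith) hp
  rw [add_sub_cancel, Real.div_rpow hy hx.le, le_div_iff₀ (Real.rpow_pos_of_pos hx p)] at h
  have e : x ^ p = x ^ (p - 1) * x := by
    rw [← Real.rpow_add_one hx.ne', sub_add_cancel]
  have e2 : (1 + p * (y / x - 1)) * x ^ p = x ^ p + p * (x ^ (p - 1) * (y - x)) := by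
    rw [e]; field_simp
  linarith

/-- The same tangent inequality, now with `x = 0` allowed. It bounds a difference quotient from
above by the derivative at its far end, which may be `0`. For `x = 0` and `p = 1` it is an equality
because `0 ^ 0 = 1`. -/
theorem rpow_sub_rpow_le' {p : ℝ} (hp : 1 ≤ p) {x y : ℝ} (hx : 0 ≤ x) (hy : 0 < y) :
    x ^ p - y ^ p ≤ p * (x ^ (p - 1) * (x - y)) := by
  rcases hx.eq_or_lt with rfl | hx
  · rcases hp.eq_or_lt with rfl | hp
    · simp
    · rw [Real.zero_rpow (by linarith), Real.zero_rpow (by linarith)]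
      have := Real.rpow_nonneg hy.le p
      linarith
  · have := rpow_sub_rpow_le hp hx hy.le
    nlinarith

variable {α : Type*} [MeasurableSpace α] {μ : Measure α} {p : ℝ}

theorem MemLp.integrable_rpow_of_nonneg (hp : 1 ≤ p) {A : α → ℝ}
    (hA : MemLp A (ENNReal.ofReal p) μ) (hA0 : 0 ≤ᵐ[μ] A) : Integrable (fun x => A x ^ p) μ := by
  have h := hA.integrable_norm_rpow (by simpa using zero_lt_one.trans_le hp) ENNReal.ofReal_ne_top
  rw [ENNReal.toReal_ofReal (zero_le_one.trans hp)] at h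
  refine h.congr ?_
  filter_upwards [hA0] with x hx
  rw [Real.norm_of_nonneg hx]

/-- Passage to the limit `t → 0` in the inequality `t c ≤ ∫ (((1 - t a) A + t G)ᵖ - Aᵖ) / p`. -/
theorem le_integral_of_forall_rpow_le (hp : 1 ≤ p) {A G : α → ℝ} (hAm : Measurable A)
    (hGm : Measurable G) (hA : MemLp A (ENNReal.ofReal p) μ) (hG : MemLp G (ENNReal.ofReal p) μ)
    (hA0 : 0 ≤ᵐ[μ] A) (hG0 : 0 ≤ᵐ[μ] G) {a c : ℝ}
    (h : ∀ t, 0 < t → t * |a| ≤ 1 → t * c ≤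
      ∫ x in {x | 0 < A x}, (((1 - t * a) * A x + t * G x) ^ p - A x ^ p) / p ∂μ) :
    c ≤ ∫ x in {x | 0 < A x}, A x ^ (p - 1) * (G x - a * A x) ∂μ := by
  have hp0 : 0 < p := zero_lt_one.trans_le hp
  set S : Set α := {x | 0 < A x}
  have hS : MeasurableSet S := measurableSet_lt measurable_const hAm
  have hS' : ∀ᵐ x ∂μ.restrict S, 0 < A x := ae_restrict_mem hS
  have hG0' : ∀ᵐ x ∂μ.restrict S, 0 ≤ G x := ae_restrict_of_ae hG0
  let u : ℝ → α → ℝ := fun t x => (1 - t * a) * A x + t * G x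
  have hum : ∀ t, Measurable (u t) := fun t => (hAm.const_mul _).add (hGm.const_mul _)
  have hDm : ∀ t, Measurable fun x => u t x ^ (p - 1) * (G x - a * A x) := fun t =>
    ((hum t).pow_const _).mul (hGm.sub (hAm.const_mul _))
  -- For `0 < t ≤ 1` and `t |a| ≤ 1` the factor `1 - t a` lies in `[0, 2]`, so `0 ≤ u t ≤ 2A + G`.
  -- Also `|G - a A| ≤ (1 + |a|)(2A + G)`, and the product of the two estimates is this integrable
  -- majorant.
  let bound : α → ℝ := fun x => (1 + |a|) * (2 * A x + G x) ^ p
  have hbi : Integrable bound (μ.restrict S) := by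
    refine (Integrable.const_mul ?_ _).integrableOn
    refine MemLp.integrable_rpow_of_nonneg hp ((hA.const_mul 2).add hG) ?_
    filter_upwards [hA0, hG0] with x h1 h2
    simp only [Pi.zero_apply] at h1 h2
    simp only [Pi.zero_apply]; positivity
  have hu0 : ∀ t, 0 < t → t * |a| ≤ 1 → ∀ x, 0 < A x → 0 ≤ G x → 0 ≤ u t x := by
    intro t ht hta x hx hGx
    have h1 : t * a ≤ 1 := (mul_le_mul_of_nonneg_left (le_abs_self a) ht.le).trans hta
    exact add_nonneg (mul_nonneg (by linarith) hx.le) (mul_nonneg ht.le hGx)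
  have hbound : ∀ t, 0 < t → t ≤ 1 → t * |a| ≤ 1 → ∀ x, 0 < A x → 0 ≤ G x →
      ‖u t x ^ (p - 1) * (G x - a * A x)‖ ≤ bound x := by
    intro t ht ht1 hta x hx hGx
    have h1 : -1 ≤ t * a := by
      have := mul_le_mul_of_nonneg_left (neg_abs_le a) ht.le
      linarith
    have h2 : u t x ≤ 2 * A x + G x := by
      have e1 : (1 - t * a) * A x ≤ 2 * A x := mul_le_mul_of_nonneg_right (by linarith) hx.le
      have e2 : t * G x ≤ G x := mul_le_of_le_one_left hGx ht1
      exact add_le_add e1 e2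
    have hU : 0 < 2 * A x + G x := by linarith
    have h3 : u t x ^ (p - 1) ≤ (2 * A x + G x) ^ (p - 1) :=
      Real.rpow_le_rpow (hu0 t ht hta x hx hGx) h2 (by linarith)
    have h4 : |G x - a * A x| ≤ (1 + |a|) * (2 * A x + G x) := by
      refine (abs_sub _ _).trans ?_
      rw [abs_mul, abs_of_pos hx, abs_of_nonneg hGx]
      nlinarith [abs_nonneg a, mul_nonneg (abs_nonneg a) hx.le, mul_nonneg (abs_nonneg a) hGx]
    rw [norm_mul, Real.norm_eq_abs, Real.norm_eq_abs,
      abs_of_nonneg (Real.rpow_nonneg (hu0 t ht hta x hx hGx) _)]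
    refine (mul_le_mul h3 h4 (abs_nonneg _) (Real.rpow_nonneg hU.le _)).trans_eq ?_
    simp only [bound]
    have e : (2 * A x + G x) ^ p = (2 * A x + G x) ^ (p - 1) * (2 * A x + G x) := by
      rw [← Real.rpow_add_one hU.ne', sub_add_cancel]
    rw [e]; ring
  have hsmall : ∀ᶠ t : ℝ in 𝓝[>] 0, 0 < t ∧ t ≤ 1 ∧ t * |a| ≤ 1 := by
    have h1 : ∀ᶠ t : ℝ in 𝓝[>] 0, t < (1 + |a|)⁻¹ :=
      nhdsWithin_le_nhds (gt_mem_nhds (by positivity))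
    filter_upwards [self_mem_nhdsWithin, h1] with t ht h1
    have ht : 0 < t := ht
    rw [← one_div, lt_div_iff₀ (by positivity)] at h1
    have := mul_nonneg ht.le (abs_nonneg a)
    exact ⟨ht, by nlinarith, by nlinarith⟩
  have hlim : Tendsto (fun t => ∫ x in S, u t x ^ (p - 1) * (G x - a * A x) ∂μ) (𝓝[>] 0)
      (𝓝 (∫ x in S, A x ^ (p - 1) * (G x - a * A x) ∂μ)) := by
    refine tendsto_integral_filter_of_dominated_convergence bound
      (Eventually.of_forall fun t => (hDm t).aestronglyMeasurable) ?_ hbi ?_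
    · filter_upwards [hsmall] with t ⟨h1, h2, h3⟩
      filter_upwards [hS', hG0'] with x hx hGx
      exact hbound t h1 h2 h3 x hx hGx
    · filter_upwards [hS'] with x hx
      have hc : Tendsto (fun t => u t x) (𝓝[>] 0) (𝓝 (A x)) := by
        have hc : Continuous fun t => u t x := by fun_prop
        have := hc.tendsto 0
        simp only [u, zero_mul, sub_zero, one_mul, add_zero] at this
        exact this.mono_left nhdsWithin_le_nhds
      exact (hc.rpow_const (Or.inl hx.ne')).mul_const _
  refine ge_of_tendsto hlim ?_
  filter_upwards [hsmall] with t ⟨h1, h2, h3⟩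
  have hi2 : Integrable (fun x => u t x ^ (p - 1) * (G x - a * A x)) (μ.restrict S) := by
    refine hbi.mono' (hDm t).aestronglyMeasurable ?_
    filter_upwards [hS', hG0'] with x hx hGx
    exact hbound t h1 h2 h3 x hx hGx
  have hi1 : Integrable (fun x => (u t x ^ p - A x ^ p) / p) (μ.restrict S) := by
    refine Integrable.div_const (Integrable.sub ?_ ?_) p
    · refine MemLp.integrable_rpow_of_nonneg hp
        (((hA.const_mul (1 - t * a)).add (hG.const_mul t)).restrict S) ?_
      filter_upwards [hS', hG0'] with x hx hGx
      exact hu0 t h1 h3 x hx hGx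
    · exact (MemLp.integrable_rpow_of_nonneg hp hA hA0).integrableOn
  -- Convexity at the endpoint `u t`, with `u t - A = t (G - a A)`, makes the factor `t` explicit,
  -- so that it cancels before the limit is taken.
  have h5 : t * c ≤ ∫ x in S, t * (u t x ^ (p - 1) * (G x - a * A x)) ∂μ := by
    refine (h t h1 h3).trans (integral_mono_ae hi1 (hi2.const_mul t) ?_)
    filter_upwards [hS', hG0'] with x hx hGx
    have h6 := rpow_sub_rpow_le' hp (hu0 t h1 h3 x hx hGx) hx
    rw [div_le_iff₀ hp0]
    refine h6.trans_eq ?_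
    simp only [u]; ring
  rw [integral_const_mul] at h5
  exact le_of_mul_le_mul_left h5 h1

end FirstVariation

/-! ### The density `|DF|^{p/q}` -/

section GradPow

/-- The case `q = ∞` is included: then `p = 1`, and `p / q.toReal` is a division by zero with value
`0 = p - 1`. The exponent in `gradPow` thus respects the convention `a^{p/q} = 1` for `a > 0`. -/
theorem div_toReal_of_holderConjugate {p : ℝ} (hp : 1 ≤ p) {q : ℝ≥0∞}
    (hpq : ENNReal.HolderConjugate (ENNReal.ofReal p) q) : p / q.toReal = p - 1 := by
  have hp0 : 0 < p := zero_lt_one.trans_le hp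
  have h := hpq.inv_add_inv_eq_inv
  have hq : q⁻¹ ≠ ∞ := ENNReal.inv_ne_top.2 hpq.symm.ne_zero
  have hp' : (ENNReal.ofReal p)⁻¹ ≠ ∞ := ENNReal.inv_ne_top.2 (by simpa using hp0)
  have h2 := congrArg ENNReal.toReal h
  rw [ENNReal.toReal_add hp' hq, ENNReal.toReal_inv, ENNReal.toReal_inv,
    ENNReal.toReal_ofReal hp0.le, inv_one, ENNReal.toReal_one] at h2
  rw [div_eq_mul_inv, eq_sub_of_add_eq' h2]
  field_simp

theorem gradPow_nonneg (p : ℝ) (q : ℝ≥0∞) {a : ℝ} (ha : 0 ≤ a) : 0 ≤ gradPow p q a := by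
  unfold gradPow
  split_ifs
  exacts [le_rfl, Real.rpow_nonneg ha _]

theorem gradPow_of_pos {p : ℝ} (hp : 1 ≤ p) {q : ℝ≥0∞}
    (hpq : ENNReal.HolderConjugate (ENNReal.ofReal p) q) {a : ℝ} (ha : 0 < a) :
    gradPow p q a = a ^ (p - 1) := by
  rw [gradPow, if_neg ha.ne', div_toReal_of_holderConjugate hp hpq]

theorem mul_gradPow {p : ℝ} (hp : 1 ≤ p) {q : ℝ≥0∞}
    (hpq : ENNReal.HolderConjugate (ENNReal.ofReal p) q) {a : ℝ} (ha : 0 ≤ a) :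
    a * gradPow p q a = a ^ p := by
  rcases ha.eq_or_lt with rfl | ha
  · rw [zero_mul, Real.zero_rpow (by linarith)]
  · rw [gradPow_of_pos hp hpq ha, mul_comm, ← Real.rpow_add_one ha.ne', sub_add_cancel]

theorem measurable_gradPow (p : ℝ) (q : ℝ≥0∞) : Measurable (gradPow p q) :=
  Measurable.ite (measurableSet_singleton 0) measurable_const (measurable_id.pow_const _)

/-- For finite `q` the `q`-th power of `A^{p/q}` is `A^p`. For `q = ∞` the exponent is `0` and the
function takes only the values `0` and `1`. -/
theorem memLp_gradPow {α : Type*} [MeasurableSpace α] {μ : Measure α} {p : ℝ} (hp : 1 ≤ p)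
    {q : ℝ≥0∞} (hpq : ENNReal.HolderConjugate (ENNReal.ofReal p) q) {A : α → ℝ}
    (hA : MemLp A (ENNReal.ofReal p) μ) (hA0 : 0 ≤ᵐ[μ] A) :
    MemLp (fun x => gradPow p q (A x)) q μ := by
  have hm : AEStronglyMeasurable (fun x => gradPow p q (A x)) μ :=
    ((measurable_gradPow p q).comp_aemeasurable hA.1.aemeasurable).aestronglyMeasurable
  rcases eq_or_ne q ∞ with rfl | hq
  · refine memLp_top_of_bound hm 1 (Eventually.of_forall fun x => ?_)
    unfold gradPow
    split_ifs <;> simp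
  · have hp0 : 0 < p := zero_lt_one.trans_le hp
    have h := hA.norm_rpow_div (ENNReal.ofReal p / q)
    have e : ENNReal.ofReal p / (ENNReal.ofReal p / q) = q :=
      ENNReal.div_div_cancel (by simpa using hp0) ENNReal.ofReal_ne_top
    rw [e, ENNReal.toReal_div, ENNReal.toReal_ofReal hp0.le] at h
    refine h.mono hm ?_
    filter_upwards [hA0] with x hx
    unfold gradPow
    split_ifs
    · simp
    · rw [Real.norm_of_nonneg hx]

end GradPow

/-! ### Boundedly supported Lipschitz functions as a vector space -/

section Lipschitz

variable {X : Type*} [MetricSpace X]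

variable (X) in
/-- The vector space of bounded Lipschitz functions with bounded support. -/
def lipBSSubmodule : Submodule ℝ (X → ℝ) where
  carrier := {ψ | (∃ K : ℝ≥0, LipschitzWith K ψ) ∧ (∃ C : ℝ, ∀ x, |ψ x| ≤ C) ∧
    Bornology.IsBounded (Function.support ψ)}
  zero_mem' := ⟨⟨0, LipschitzWith.const 0⟩, ⟨0, by simp⟩, by simp⟩
  add_mem' := by
    rintro ψ ψ' ⟨⟨K, hK⟩, ⟨C, hC⟩, hb⟩ ⟨⟨K', hK'⟩, ⟨C', hC'⟩, hb'⟩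
    exact ⟨⟨K + K', hK.add hK'⟩,
      ⟨C + C', fun x => (abs_add_le _ _).trans (add_le_add (hC x) (hC' x))⟩,
      (hb.union hb').subset (Function.support_add _ _)⟩
  smul_mem' := by
    rintro c ψ ⟨⟨K, hK⟩, ⟨C, hC⟩, hb⟩
    refine ⟨⟨‖c‖₊ * K, ?_⟩, ⟨|c| * C, fun x => ?_⟩, hb.subset (Function.support_const_smul_subset _ _)⟩
    · exact (lipschitzWith_smul c).comp hK
    · rw [Pi.smul_apply, smul_eq_mul, abs_mul]
      exact mul_le_mul_of_nonneg_left (hC x) (abs_nonneg c)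

/-- An element of `lipBSSubmodule X` as a boundedly supported Lipschitz function. -/
def lipBSSubmodule.toLipBS (ψ : lipBSSubmodule X) : LipBS X := ⟨ψ, ψ.2.1, ψ.2.2.1, ψ.2.2.2⟩

/-- A boundedly supported Lipschitz function as an element of `lipBSSubmodule X`. -/
def LipBS.toSubmodule (ψ : LipBS X) : lipBSSubmodule X :=
  ⟨ψ.toFun, ψ.lipschitz, ψ.bounded, ψ.isBounded_support⟩

variable [MeasurableSpace X]

theorem BFSignedMeasure.posPart_lt_top (μ : BFSignedMeasure X) {S : Set X} (hS : MeasurableSet S)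
    (hb : Bornology.IsBounded S) : μ.posPart S < ∞ := by
  rw [μ.posPart_apply ⟨S, hS, hb⟩ hS Subset.rfl]
  exact measure_lt_top _ _

variable [BorelSpace X]

/-- The linear map that takes a boundedly supported Lipschitz function to its class. -/
def lipToDirichlet (m : Measure X) [BoundedlyFinite m] (p : ℝ) [Fact (1 ≤ p)] :
    lipBSSubmodule X →ₗ[ℝ] Dirichlet m p where
  toFun ψ := (lipBSSubmodule.toLipBS ψ).toDirichlet m p
  map_add' _ _ := Subtype.ext rfl
  map_smul' _ _ := Subtype.ext rfl

theorem LipBS.integrable_posPart (ψ : LipBS X) (μ : BFSignedMeasure X) :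
    Integrable ψ.toFun μ.posPart := by
  obtain ⟨C, hC⟩ := ψ.bounded
  have hS : MeasurableSet (Function.support ψ.toFun) := ψ.continuous.isOpen_support.measurableSet
  rw [← integrableOn_iff_integrable_of_support_subset (Subset.refl (Function.support ψ.toFun))]
  exact Measure.integrableOn_of_bounded (μ.posPart_lt_top hS ψ.isBounded_support).ne
    ψ.continuous.measurable.aestronglyMeasurable (M := C) (Eventually.of_forall hC)

/-- The integral of boundedly supported Lipschitz functions against a boundedly-finite signed
measure, as a linear map. -/
def BFSignedMeasure.integralₗ (μ : BFSignedMeasure X) : lipBSSubmodule X →ₗ[ℝ] ℝ where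
  toFun ψ := μ.integral ψ
  map_add' ψ ψ' := by
    have h := fun μ : BFSignedMeasure X => integral_add
      ((lipBSSubmodule.toLipBS ψ).integrable_posPart μ)
      ((lipBSSubmodule.toLipBS ψ').integrable_posPart μ)
    have h1 := h μ
    -- The negative part is by definition the positive part of `-μ`.
    have h2 := h (-μ)
    simp only [lipBSSubmodule.toLipBS] at h1 h2
    simp only [BFSignedMeasure.integral, BFSignedMeasure.negPart, Submodule.coe_add, Pi.add_apply]
    rw [h1, h2]; ring
  map_smul' c ψ := by
    simp only [BFSignedMeasure.integral, Submodule.coe_smul, Pi.smul_apply, smul_eq_mul,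
      integral_const_mul, RingHom.id_apply]
    ring

end Lipschitz

/-! ### Laplacians as divergences of gradients -/

section Main

variable {X : Type*} [MetricSpace X] [SecondCountableTopology X] [MeasurableSpace X] [BorelSpace X]
variable {m : Measure X} [BoundedlyFinite m] {p : ℝ} [Fact (1 ≤ p)]

theorem integrable_gradNorm_rpow (F : Dirichlet m p) : Integrable (fun x => gradNorm F x ^ p) m :=
  MemLp.integrable_rpow_of_nonneg Fact.out (Lp.memLp _) (gradNorm_nonneg F)

theorem measurableSet_gradNorm_pos (F : Dirichlet m p) : MeasurableSet {x | 0 < gradNorm F x} :=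
  measurableSet_lt measurable_const (Lp.stronglyMeasurable _).measurable

/-- For a `p`-Laplacian `μ` of `F`, the functional `a dF + dψ ↦ a ∫ |DF|ᵖ dm - ∫ ψ dμ` is dominated
by `ω ↦ ∫ |ω| |DF|^{p/q} dm`. -/
theorem sub_integral_le_of_mem_laplacian {q : ℝ≥0∞}
    (hpq : ENNReal.HolderConjugate (ENNReal.ofReal p) q) {F : Dirichlet m p}
    {μ : BFSignedMeasure X} (hμ : μ ∈ laplacian F) (a : ℝ) (ψ : lipBSSubmodule X) :
    a * ∫ x, gradNorm F x ^ p ∂m - μ.integral ψ ≤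
      ∫ x, gradNorm (a • F + lipToDirichlet m p ψ) x * gradPow p q (gradNorm F x) ∂m := by
  have hp : 1 ≤ p := Fact.out
  have hp0 : 0 < p := zero_lt_one.trans_le hp
  set G := gradNorm (a • F + lipToDirichlet m p ψ) with hG
  have hS := measurableSet_gradNorm_pos F
  have hGi : Integrable (fun x => G x * gradPow p q (gradNorm F x)) m :=
    (Lp.memLp G).integrable_mul (memLp_gradPow hp hpq (Lp.memLp (gradNorm F)) (gradNorm_nonneg F))
  have key : -μ.integral ψ ≤ ∫ x in {x | 0 < gradNorm F x},
      gradNorm F x ^ (p - 1) * (G x - a * gradNorm F x) ∂m := by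
    refine le_integral_of_forall_rpow_le hp (Lp.stronglyMeasurable _).measurable
      (Lp.stronglyMeasurable _).measurable (Lp.memLp _) (Lp.memLp _) (gradNorm_nonneg _)
      (gradNorm_nonneg _) fun t ht hta => ?_
    have h1 := hμ (lipBSSubmodule.toLipBS (t • ψ))
    have h2 : μ.integral (t • ψ : lipBSSubmodule X) = t * μ.integral ψ :=
      μ.integralₗ.map_smul t ψ
    -- This splitting brings in the form `a dF + dψ` itself. For `t |a| ≤ 1` both coefficients are
    -- nonnegative whatever the sign of `a`, so sublinearity gives `|D(F + tψ)| ≤ (1 - ta)|DF| + t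
    -- |D(aF + ψ)|`.
    have h3 : F + (lipBSSubmodule.toLipBS (t • ψ)).toDirichlet m p =
        (1 - t * a) • F + t • (a • F + lipToDirichlet m p ψ) := by
      change F + lipToDirichlet m p (t • ψ) = _
      rw [map_smul]
      module
    have h4 : 0 ≤ 1 - t * a := by
      have := mul_le_mul_of_nonneg_left (le_abs_self a) ht.le
      linarith
    have h5 : t * -μ.integral ψ = -μ.integral (lipBSSubmodule.toLipBS (t • ψ)).toFun := by
      rw [mul_neg, ← h2]
      rfl
    rw [h5]
    refine h1.trans (integral_mono_ae ?_ ?_ (ae_restrict_of_ae ?_))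
    · exact (((integrable_gradNorm_rpow _).sub (integrable_gradNorm_rpow _)).div_const p).integrableOn
    · refine (((MemLp.integrable_rpow_of_nonneg hp (((Lp.memLp (gradNorm F)).const_mul
        (1 - t * a)).add ((Lp.memLp G).const_mul t)) ?_).sub
        (integrable_gradNorm_rpow _)).div_const p).integrableOn
      filter_upwards [gradNorm_nonneg F, gradNorm_nonneg (a • F + lipToDirichlet m p ψ)] with x e1 e2
      exact add_nonneg (mul_nonneg h4 e1) (mul_nonneg ht.le e2)
    · rw [h3]
      filter_upwards [gradNorm_add_le ((1 - t * a) • F) (t • (a • F + lipToDirichlet m p ψ)),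
        gradNorm_smul (1 - t * a) F, gradNorm_smul t (a • F + lipToDirichlet m p ψ),
        gradNorm_nonneg ((1 - t * a) • F + t • (a • F + lipToDirichlet m p ψ))] with x e1 e2 e3 e4
      rw [e2, e3, abs_of_nonneg h4, abs_of_pos ht] at e1
      exact div_le_div_of_nonneg_right
        (sub_le_sub_right (Real.rpow_le_rpow e4 e1 hp0.le) _) hp0.le
  rw [← integral_indicator hS] at key
  -- Where `|DF| = 0` both `|DF|^{p/q}` and `|DF|^p` vanish, so the cutoff in the Laplacian is
  -- absorbed by the convention for `gradPow`. This matters for `p = 1`, where `0 ^ (p - 1) = 1`.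
  have h6 : ∫ x, ({x | 0 < gradNorm F x}.indicator
      fun x => gradNorm F x ^ (p - 1) * (G x - a * gradNorm F x)) x ∂m =
      ∫ x, (G x * gradPow p q (gradNorm F x) - a * gradNorm F x ^ p) ∂m := by
    refine integral_congr_ae ?_
    filter_upwards [gradNorm_nonneg F] with x hx
    rcases hx.eq_or_lt with hx0 | hx0
    · rw [indicator_of_notMem (by simp [← hx0]), ← hx0, Real.zero_rpow hp0.ne', gradPow, if_pos rfl]
      ring
    · rw [indicator_of_mem (by exact hx0), ← mul_gradPow hp hpq hx, gradPow_of_pos hp hpq hx0]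
      ring
  rw [h6, integral_sub hGi ((integrable_gradNorm_rpow F).const_mul a), integral_const_mul] at key
  linarith

/-- The functional to be extended prescribes its value on `dF` besides those on the `dψ`: the latter
only control the divergence, while the former forces the field to be a gradient of `F`. -/
theorem exists_grad_isDivergence_of_mem_laplacian {q : ℝ≥0∞}
    (hpq : ENNReal.HolderConjugate (ENNReal.ofReal p) q) {F : Dirichlet m p}
    {μ : BFSignedMeasure X} (hμ : μ ∈ laplacian F) :
    ∃ w : Tangent m p, w ∈ Grad q F ∧ IsDivergence w μ := by
  have hp : 1 ≤ p := Fact.out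
  have hp0 : 0 < p := zero_lt_one.trans_le hp
  have hbL := memLp_gradPow hp hpq (Lp.memLp (gradNorm F)) (gradNorm_nonneg F)
  set b : Lp ℝ q m := hbL.toLp with hbdef
  have hb : b =ᵐ[m] fun x => gradPow p q (gradNorm F x) := hbL.coeFn_toLp
  have hb0 : 0 ≤ᵐ[m] b := by
    filter_upwards [hb, gradNorm_nonneg F] with x h1 h2
    rw [h1]
    exact gradPow_nonneg p q h2
  let T : ℝ × lipBSSubmodule X →ₗ[ℝ] Cotangent m p :=
    differential ∘ₗ (LinearMap.toSpanSingleton ℝ _ F).coprod (lipToDirichlet m p)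
  let l : ℝ × lipBSSubmodule X →ₗ[ℝ] ℝ :=
    (LinearMap.toSpanSingleton ℝ ℝ (∫ x, gradNorm F x ^ p ∂m)).coprod (-μ.integralₗ)
  have hT : ∀ a ψ, T (a, ψ) = differential (a • F + lipToDirichlet m p ψ) := fun a ψ => by
    simp [T]
  have hl : ∀ a ψ, l (a, ψ) = a * ∫ x, gradNorm F x ^ p ∂m - μ.integral ψ := fun a ψ => by
    simp [l, BFSignedMeasure.integralₗ, sub_eq_add_neg]
  have hint : ∀ ω : Cotangent m p, Integrable (fun x => cotangentNorm ω x * b x) m :=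
    fun ω => integrable_cotangentNorm_mul ω b
  obtain ⟨L, hL, hLb⟩ := exists_linear_extension_of_le_sublinear T l
    (fun ω => ∫ x, cotangentNorm ω x * b x ∂m)
    (fun c hc ω => by
      rw [← integral_const_mul, cotangentNorm_smul, abs_of_pos hc]
      refine integral_congr_ae ?_
      filter_upwards [Lp.coeFn_smul c (cotangentNorm ω)] with x hx
      rw [hx, Pi.smul_apply, smul_eq_mul, mul_assoc])
    (fun ω η => by
      rw [← integral_add (hint ω) (hint η)]
      refine integral_mono_ae (hint _) ((hint ω).add (hint η)) ?_
      filter_upwards [ae_cotangentNorm_add_le ω η, hb0] with x h1 h2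
      exact (mul_le_mul_of_nonneg_right h1 h2).trans_eq (add_mul _ _ _))
    (fun ⟨a, ψ⟩ => by
      rw [hT, hl, cotangentNorm_differential]
      refine (sub_integral_le_of_mem_laplacian hpq hμ a ψ).trans_eq (integral_congr_ae ?_)
      filter_upwards [hb] with x hx
      rw [hx])
  obtain ⟨w, hw, hwb⟩ := exists_tangent_of_le L b hb0 hLb
  have hwb' : ∀ ω, ∀ᵐ x ∂m, w ω x ≤ cotangentNorm ω x * gradPow p q (gradNorm F x) := fun ω => by
    filter_upwards [hwb ω, hb] with x h1 h2
    rw [← h2]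
    exact (le_abs_self _).trans h1
  -- The domination gives `≤` pointwise, and the pair `(1, 0)` gives equal integrals; hence equality
  -- a.e.
  have hdF : w (differential F) =ᵐ[m] fun x => gradNorm F x ^ p := by
    have h1 : w (differential F) ≤ᵐ[m] fun x => gradNorm F x ^ p := by
      filter_upwards [hwb' (differential F), gradNorm_nonneg F] with x h1 h2
      rw [cotangentNorm_differential] at h1
      rwa [← mul_gradPow hp hpq h2]
    have h2 : ∫ x, w (differential F) x ∂m = ∫ x, gradNorm F x ^ p ∂m := by
      have h3 := hL (1, 0)
      rw [hT, hl, map_zero, add_zero, one_smul, one_mul] at h3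
      rw [hw, h3]
      have h4 : μ.integral ((0 : lipBSSubmodule X) : X → ℝ) = 0 := μ.integralₗ.map_zero
      rw [h4, sub_zero]
    exact (integral_eq_iff_of_ae_le (L1.integrable_coeFn _) (integrable_gradNorm_rpow F) h1).1 h2
  have hle : w.pointwiseNorm ≤ᵐ[m] fun x => ENNReal.ofReal (gradPow p q (gradNorm F x)) :=
    Tangent.pointwiseNorm_le
      ((measurable_gradPow p q).comp (Lp.stronglyMeasurable (gradNorm F)).measurable)
      (by filter_upwards [gradNorm_nonneg F] with x hx using gradPow_nonneg p q hx) hwb'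
  refine ⟨w, ⟨hdF, ?_⟩, fun ψ => ?_⟩
  -- The lower bound on `|w|` comes from `|DF| |DF|^{p/q} = dF(w) ≤ |DF| |w|` by dividing where
  -- `|DF| > 0`; elsewhere the bound is `0`.
  · filter_upwards [hle, hdF, w.apply_le_mul_pointwiseNorm (differential F), gradNorm_nonneg F] with x h1 h2 h3 h4
    have hfin : w.pointwiseNorm x ≠ ∞ := ne_top_of_le_ne_top ENNReal.ofReal_ne_top h1
    refine le_antisymm h1 ?_
    have h5 := h3 hfin
    rw [h2, cotangentNorm_differential, ← mul_gradPow hp hpq h4] at h5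
    rcases h4.eq_or_lt with h0 | h0
    · rw [← h0, gradPow, if_pos rfl, ENNReal.ofReal_zero]
      exact zero_le
    · exact ENNReal.ofReal_le_of_le_toReal (le_of_mul_le_mul_left h5 h0)
  -- The pairs with `a = 0` encode the divergence.
  · have h3 := hL (0, ψ.toSubmodule)
    rw [hT, hl, zero_smul, zero_add, zero_mul, zero_sub] at h3
    rw [hw]
    exact h3

/-- The inequality already holds between the integrands: `dψ(v)` is at most the energy increment on
`{|DF| > 0}` and at most `0` elsewhere. -/
theorem mem_laplacian_of_isDivergence {q : ℝ≥0∞}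
    (hpq : ENNReal.HolderConjugate (ENNReal.ofReal p) q) {F : Dirichlet m p}
    {μ : BFSignedMeasure X} {v : Tangent m p} (hv : v ∈ Grad q F) (hμ : IsDivergence v μ) :
    μ ∈ laplacian F := by
  intro ψ
  have hp : 1 ≤ p := Fact.out
  have hp0 : 0 < p := zero_lt_one.trans_le hp
  obtain ⟨hv1, hv2⟩ := hv
  rw [← hμ ψ, ← integral_indicator (measurableSet_gradNorm_pos F)]
  refine integral_mono_ae (L1.integrable_coeFn _)
    ((((integrable_gradNorm_rpow _).sub (integrable_gradNorm_rpow _)).div_const p).indicator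
      (measurableSet_gradNorm_pos F)) ?_
  have hadd : v (differential (F + ψ.toDirichlet m p)) =
      v (differential F) + v (differential (ψ.toDirichlet m p)) := by
    rw [map_add, map_add]
  have hsum := Lp.coeFn_add (v (differential F)) (v (differential (ψ.toDirichlet m p)))
  rw [← hadd] at hsum
  filter_upwards [hv1, hv2, v.apply_le_mul_pointwiseNorm (differential (F + ψ.toDirichlet m p)),
    v.apply_le_mul_pointwiseNorm (differential (ψ.toDirichlet m p)), hsum, gradNorm_nonneg F,
    gradNorm_nonneg (F + ψ.toDirichlet m p)] with x h1 h2 h3 h4 h5 h6 h7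
  have hfin : v.pointwiseNorm x ≠ ∞ := by rw [h2]; exact ENNReal.ofReal_ne_top
  have hn : (v.pointwiseNorm x).toReal = gradPow p q (gradNorm F x) := by
    rw [h2, ENNReal.toReal_ofReal (gradPow_nonneg p q h6)]
  have h3 := h3 hfin
  have h4 := h4 hfin
  rw [hn, cotangentNorm_differential] at h3 h4
  -- Where `|DF| = 0` the field vanishes and `dψ(v) ≤ |dψ| · 0`. Where `|DF| > 0` the bound on `d(F
  -- + ψ)(v)` is combined with the tangent line inequality at `|DF|`.
  rcases h6.eq_or_lt with h0 | h0
  · rw [indicator_of_notMem (by simp [← h0])]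
    rwa [← h0, gradPow, if_pos rfl, mul_zero] at h4
  · rw [indicator_of_mem (by exact h0), le_div_iff₀ hp0]
    rw [h5, Pi.add_apply, h1, ← mul_gradPow hp hpq h6, gradPow_of_pos hp hpq h0] at h3
    have h8 := rpow_sub_rpow_le hp h0 h7
    refine le_trans ?_ h8
    rw [mul_comm]
    refine mul_le_mul_of_nonneg_left ?_ hp0.le
    linarith

end Main

end MetricSobolev

end

theorem mainTheorem5 {X : Type*} [MetricSpace X] [CompleteSpace X] [SecondCountableTopology X]
    [MeasurableSpace X] [BorelSpace X] (m : Measure X) [MetricSobolev.BoundedlyFinite m]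
    (p : ℝ) [Fact (1 ≤ p)] (q : ℝ≥0∞) (hpq : ENNReal.HolderConjugate (ENNReal.ofReal p) q)
    (f : MetricSobolev.Dirichlet m p) :
    (∀ μ ∈ MetricSobolev.laplacian f, ∃ w : MetricSobolev.Tangent m p,
      w ∈ MetricSobolev.Grad q f ∧ MetricSobolev.IsDivergence w μ) ∧
    MetricSobolev.laplacian f =
      {μ | ∃ v ∈ MetricSobolev.Grad q f, MetricSobolev.IsDivergence v μ} := by
  have h : ∀ μ ∈ MetricSobolev.laplacian f, ∃ w : MetricSobolev.Tangent m p,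
      w ∈ MetricSobolev.Grad q f ∧ MetricSobolev.IsDivergence w μ :=
    fun _ hμ => MetricSobolev.exists_grad_isDivergence_of_mem_laplacian hpq hμ
  exact ⟨h, Set.Subset.antisymm h fun _ ⟨_, hv, hμ⟩ =>
    MetricSobolev.mem_laplacian_of_isDivergence hpq hv hμ⟩
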